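/- Let $\mu$ be the normalised Haar measure on $\mathrm{SU}(2)$, let ${\bm Z}_1,{\bm Z}_2,{\bm Z}_3$ be the left-invariant vector fields on $\mathrm{SU}(2)$ generated by $-\tfrac{i}{2}\sigma_k$ ($\sigma_k$ the Pauli matrices), so that $[{\bm Z}_i,{\bm Z}_j]=\epsilon_{ijk}{\bm Z}_k$, and put ${\bm X}_\pm=-({\bm Z}_2\pm i{\bm Z}_1)$, ${\bm Z}^\alpha={\bm Z}_1^{\alpha_1}{\bm Z}_2^{\alpha_2}{\bm Z}_3^{\alpha_3}$. For $\rho_\star>0$ and $0<\varepsilon<1$ let \[\underline{\mathcal N}_\varepsilon=\Big\{(\tau,\rho,g)\in\mathbb R\times\mathbb R\times\mathrm{SU}(2): -1\le\tau\le-1+\varepsilon,\ 0\le\rho\le\tfrac{2\rho_\star}{1-\tau}\Big\},\] \[\mathscr I^-_{\rho_\star}=\{\tau=-1,\ 0\le\rho\le\rho_\star\},\qquad \underline{\mathcal B}_\varepsilon=\Big\{-1\le\tau\le-1+\varepsilon,\ \rho=\tfrac{2\rho_\star}{1-\tau}\Big\},\] let $\mathrm{dv}=\mathrm d\tau\,\mathrm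 d\rho\,\mathrm d\mu$, and let $\mathrm d\underline{\mathcal B}$ be the measure induced on $\underline{\mathcal B}_\varepsilon$ by contracting $\mathrm{dv}$ with $\tfrac1{\sqrt2}\big((1+\tau)\partial_\tau-\rho\partial_\rho\big)$. For $m\in\mathbb N$ put \[\|f\|^2_{H^m(\underline{\mathcal N}_\varepsilon)}=\sum_{p'+q'+|\alpha|\le m}\int_{\underline{\mathcal N}_\varepsilon}|\partial_\rho^{p'}\partial_\tau^{q'}{\bm Z}^\alpha f|^2\,\mathrm{dv}.\] Let $m,p,q\in\mathbb N$ with $m+p<q$. Then there is a constant $C>0$ depending only on $m,p,q$ (in particular independent of $\varepsilon$) such that the following holds for all $\rho_\star>0$, $0<\varepsilon<1$ and $\Omega_\star>0$. Let $\psi,\psi_0,\psi_1,\psi_2$ be complex-valued functions of class $C^{m+p+q+1}$ in a neighbourhood of every point of $\underline{\mathcal N}_\varepsilon\cap\{\rho>0\}$ which satisfy on $\underline{\mathcal N}_\varepsilon\cap\{\rho>0\}$ the transport equations (the first-order form of the conformal wave equation near spatial infinity of Minkowski space) \begin{align*} (1+\tau)\partial_\tau\psi_2-\rho\partial_\rho\psi_2-\tfrac12{\bm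 X}_-\psi-{\bm X}_-\psi_1&=0,\\ (1-\tau)\partial_\tau\psi_1+\rho\partial_\rho\psi_1+\tfrac12\big((1-\tau)\partial_\tau\psi+\rho\partial_\rho\psi\big)-{\bm X}_+\psi_2-\tfrac12\psi-\psi_1&=0,\\ (1+\tau)\partial_\tau\psi_1-\rho\partial_\rho\psi_1-\tfrac12\big((1+\tau)\partial_\tau\psi-\rho\partial_\rho\psi\big)-{\bm X}_-\psi_0-\tfrac12\psi+\psi_1&=0,\\ (1-\tau)\partial_\tau\psi_0+\rho\partial_\rho\psi_0+\tfrac12{\bm X}_+\psi-{\bm X}_+\psi_1&=0, \end{align*} and suppose that for each $f\in\{\psi,\psi_0,\psi_1,\psi_2\}$ the characteristic data satisfy \[\sum_{p'+q'+|\alpha|\le m}\Big(\int_{\mathscr I^-_{\rho_\star}}|\partial_\rho^{p'}\partial_\tau^{q'}{\bm Z}^\alpha\partial_\tau^q\partial_\rho^pf|^2\,\mathrm d\rho\,\mathrm d\mu+\int_{\underline{\mathcal B}_\varepsilon}|\partial_\rho^{p'}\partial_\tau^{q'}{\bm Z}^\alpha\partial_\tau^q\partial_\rho^pf|^2\,\mathrm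 d\underline{\mathcal B}\Big)\le\Omega_\star.\] Then \[\sum_{k\in\{0,1\}}\|\partial_\rho^p\partial_\tau^q\psi_k\|^2_{H^m(\underline{\mathcal N}_\varepsilon)}+\|\partial_\rho^p\partial_\tau^q\psi\|^2_{H^m(\underline{\mathcal N}_\varepsilon)}\le C\,\Omega_\star.\] -/

import Mathlib

open MeasureTheory Topology
open scoped ENNReal

noncomputable section

namespace FriedrichCylinder

/-! ### The group `SU(2)`, its normalised Haar measure and its left-invariant frame -/

/-- The group `SU(2)`, with the topology inherited from the complex `2 × 2` matrices. -/
abbrev SU2 : Type := ↥(Matrix.specialUnitaryGroup (Fin 2) ℂ)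

instance : MeasurableSpace SU2 := borel SU2

instance : BorelSpace SU2 := ⟨rfl⟩

instance : IsTopologicalGroup SU2 where
  continuous_inv := by
    refine Continuous.subtype_mk (f := fun g : SU2 => star (g : Matrix (Fin 2) (Fin 2) ℂ)) ?_ _
    exact continuous_subtype_val.star

theorem isCompact_specialUnitary :
    IsCompact (Matrix.specialUnitaryGroup (Fin 2) ℂ : Set (Matrix (Fin 2) (Fin 2) ℂ)) := by
  have hK : IsCompact {A : Matrix (Fin 2) (Fin 2) ℂ |
      ∀ i, A i ∈ {v : Fin 2 → ℂ | ∀ j, v j ∈ Metric.closedBall (0 : ℂ) 1}} :=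
    isCompact_pi_infinite fun _ => isCompact_pi_infinite fun _ => isCompact_closedBall _ _
  refine hK.of_isClosed_subset ?_ ?_
  · have : (Matrix.specialUnitaryGroup (Fin 2) ℂ : Set (Matrix (Fin 2) (Fin 2) ℂ))
        = {A | A * star A = 1} ∩ {A | A.det = 1} := by
      ext A
      simp only [SetLike.mem_coe, Matrix.mem_specialUnitaryGroup_iff, Matrix.mem_unitaryGroup_iff,
        Set.mem_inter_iff, Set.mem_ofPred_eq]
    rw [this]
    exact (isClosed_eq (continuous_id.mul continuous_id.star) continuous_const).inter
      (isClosed_eq (continuous_id.matrix_det) continuous_const)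
  · intro A hA i j
    have h := entry_norm_bound_of_unitary (Matrix.specialUnitaryGroup_le_unitaryGroup hA) i j
    simpa using h

instance : CompactSpace SU2 := isCompact_iff_compactSpace.mp isCompact_specialUnitary

/-- The Haar measure `μ` on `SU(2)`, normalised to total mass `1`. -/
def haarSU2 : Measure SU2 := Measure.haarMeasure ⊤

/-- The Pauli matrices `σ₁, σ₂, σ₃` (indexed by `0, 1, 2`). -/
def pauli : Fin 3 → Matrix (Fin 2) (Fin 2) ℂ :=
  ![!![0, 1; 1, 0], !![0, -Complex.I; Complex.I, 0], !![1, 0; 0, -1]]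

/-- The matrix `cos (s/2) 1 - i sin (s/2) σₖ = exp (s uₖ)`, where `uₖ = -(i/2) σₖ ∈ su(2)`. -/
def rotMatrix (k : Fin 3) (s : ℝ) : Matrix (Fin 2) (Fin 2) ℂ :=
  (Real.cos (s / 2) : ℂ) • (1 : Matrix (Fin 2) (Fin 2) ℂ)
    - (Complex.I * (Real.sin (s / 2) : ℂ)) • pauli k

theorem rotMatrix_mem (k : Fin 3) (s : ℝ) :
    rotMatrix k s ∈ Matrix.specialUnitaryGroup (Fin 2) ℂ := by
  have h : (Real.cos (s / 2) : ℂ) ^ 2 + (Real.sin (s / 2) : ℂ) ^ 2 = 1 := by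
    exact_mod_cast Real.cos_sq_add_sin_sq (s / 2)
  have hI : Complex.I ^ 2 = -1 := Complex.I_sq
  rw [Matrix.mem_specialUnitaryGroup_iff, Matrix.mem_unitaryGroup_iff]
  unfold rotMatrix
  generalize Real.cos (s / 2) = c at *
  generalize Real.sin (s / 2) = d at *
  constructor
  · ext i j
    fin_cases k <;> fin_cases i <;> fin_cases j <;>
      simp [pauli, Matrix.mul_apply, Fin.sum_univ_two, Matrix.star_apply] <;> grind
  · fin_cases k <;> simp [pauli, Matrix.det_fin_two] <;> grind

/-- The one-parameter subgroup `s ↦ exp (s uₖ)` of `SU(2)`, with `uₖ = -(i/2) σₖ`. -/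
def rot (k : Fin 3) (s : ℝ) : SU2 := ⟨rotMatrix k s, rotMatrix_mem k s⟩

/-! ### Spacetime points and differential operators -/

/-- Points `(τ, ρ, g)` of `ℝ × ℝ × SU(2)`. -/
abbrev Pt : Type := ℝ × ℝ × SU2

/-- The measure `dv = dτ dρ dμ`. -/
def dv : Measure Pt := (volume : Measure ℝ).prod ((volume : Measure ℝ).prod haarSU2)

/-- The partial derivative `∂_τ`. -/
def dTau (f : Pt → ℂ) : Pt → ℂ := fun x => deriv (fun t : ℝ => f (t, x.2.1, x.2.2)) x.1

/-- The partial derivative `∂_ρ`. -/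
def dRho (f : Pt → ℂ) : Pt → ℂ := fun x => deriv (fun r : ℝ => f (x.1, r, x.2.2)) x.2.1

/-- The left-invariant vector field `Zₖ` generated by `uₖ`; `[Z₁, Z₂] = Z₃` and cyclically. -/
def Z (k : Fin 3) (f : Pt → ℂ) : Pt → ℂ :=
  fun x => deriv (fun s : ℝ => f (x.1, x.2.1, x.2.2 * rot k s)) 0

/-- `X₊ = -(Z₂ + i Z₁)`. -/
def XPlus (f : Pt → ℂ) : Pt → ℂ := fun x => -(Z 1 f x + Complex.I * Z 0 f x)

/-- `X₋ = -(Z₂ - i Z₁)`. -/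
def XMinus (f : Pt → ℂ) : Pt → ℂ := fun x => -(Z 1 f x - Complex.I * Z 0 f x)

/-- `Z^α = Z₁^α₁ Z₂^α₂ Z₃^α₃`. -/
def ZPow (α : ℕ × ℕ × ℕ) (f : Pt → ℂ) : Pt → ℂ :=
  (Z 0)^[α.1] ((Z 1)^[α.2.1] ((Z 2)^[α.2.2] f))

/-- `D^{p,q,α} = ∂_ρ^p ∂_τ^q Z^α`. -/
def D (p q : ℕ) (α : ℕ × ℕ × ℕ) (f : Pt → ℂ) : Pt → ℂ := dRho^[p] (dTau^[q] (ZPow α f))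

/-- The set of all `(p', q', α) ∈ ℕ × ℕ × ℕ³` with `p' + q' + |α| ≤ m`. -/
def multiIndices (m : ℕ) : Finset (ℕ × ℕ × (ℕ × ℕ × ℕ)) :=
  (Finset.range (m + 1) ×ˢ Finset.range (m + 1) ×ˢ
    (Finset.range (m + 1) ×ˢ Finset.range (m + 1) ×ˢ Finset.range (m + 1))).filter
      fun i => i.1 + i.2.1 + (i.2.2.1 + i.2.2.2.1 + i.2.2.2.2) ≤ m

/-- `ℝ × ℝ × SU(2)` as a subset of the vector space `ℝ × ℝ × M₂(ℂ)`. -/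
def ambient (x : Pt) : ℝ × ℝ × (Fin 2 → Fin 2 → ℂ) := (x.1, x.2.1, fun i j => x.2.2.1 i j)

/-- `f` is of class `C^n` in a neighbourhood of the point `x` of the manifold `ℝ × ℝ × SU(2)`:
near `x` it is the restriction of a `C^n` function on `ℝ × ℝ × M₂(ℂ)`. -/
def IsCkAt (n : ℕ) (f : Pt → ℂ) (x : Pt) : Prop :=
  ∃ F : ℝ × ℝ × (Fin 2 → Fin 2 → ℂ) → ℂ,
    ContDiffAt ℝ n F (ambient x) ∧ ∀ᶠ y in 𝓝 x, f y = F (ambient y)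

/-! ### The lower domain, the equations and the norms -/

/-- The slab bounded by past null infinity `τ = -1`, the incoming null hypersurface
`ρ = 2ρ⋆/(1-τ)`, the hypersurface `τ = -1+ε`, and the cylinder `ρ = 0`. -/
def lowerDomain (ρs ε : ℝ) : Set Pt :=
  {x | -1 ≤ x.1 ∧ x.1 ≤ -1 + ε ∧ 0 ≤ x.2.1 ∧ x.2.1 ≤ 2 * ρs / (1 - x.1)}

/-- The transport equations `A₀ = B₀ = A₁ = B₁ = 0` at the point `x`. -/
def TransportEqAt (ψ ψ₀ ψ₁ ψ₂ : Pt → ℂ) (x : Pt) : Prop :=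
  let τ : ℂ := (x.1 : ℂ)
  let ρ : ℂ := (x.2.1 : ℂ)
  ((1 + τ) * dTau ψ₂ x - ρ * dRho ψ₂ x - 1 / 2 * XMinus ψ x - XMinus ψ₁ x = 0) ∧
  ((1 - τ) * dTau ψ₁ x + ρ * dRho ψ₁ x + 1 / 2 * ((1 - τ) * dTau ψ x + ρ * dRho ψ x)
    - XPlus ψ₂ x - 1 / 2 * ψ x - ψ₁ x = 0) ∧
  ((1 + τ) * dTau ψ₁ x - ρ * dRho ψ₁ x - 1 / 2 * ((1 + τ) * dTau ψ x - ρ * dRho ψ x)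
    - XMinus ψ₀ x - 1 / 2 * ψ x + ψ₁ x = 0) ∧
  ((1 - τ) * dTau ψ₀ x + ρ * dRho ψ₀ x + 1 / 2 * XPlus ψ x - XPlus ψ₁ x = 0)

/-- The squared norm `‖f‖²_{H^m(S)} = ∑_{p'+q'+|α| ≤ m} ∫_S |∂_ρ^{p'} ∂_τ^{q'} Z^α f|² dv`,
with value `∞` when an integral diverges. -/
def sobolevSq (m : ℕ) (S : Set Pt) (f : Pt → ℂ) : ℝ≥0∞ :=
  ∑ i ∈ multiIndices m, ∫⁻ x in S, ‖D i.1 i.2.1 i.2.2 f x‖ₑ ^ 2 ∂dv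

/-- `∑_{p'+q'+|α| ≤ m} ∫ |∂_ρ^{p'} ∂_τ^{q'} Z^α f|² dρ dμ` over the portion `0 ≤ ρ ≤ ρ⋆` of past
null infinity `τ = -1`. -/
def scriDataSq (m : ℕ) (ρs : ℝ) (f : Pt → ℂ) : ℝ≥0∞ :=
  ∑ i ∈ multiIndices m, ∫⁻ y in Set.Icc 0 ρs ×ˢ (Set.univ : Set SU2),
    ‖D i.1 i.2.1 i.2.2 f (-1, y.1, y.2)‖ₑ ^ 2 ∂((volume : Measure ℝ).prod haarSU2)

/-- The density with respect to `dτ dμ` of the measure which `dv` induces on the null hypersurface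
`ρ = 2ρ⋆/(1-τ)`, that is, of the contraction of `dτ ∧ dρ ∧ dμ` with the transverse null vector
`e₁₁' = ((1+τ) ∂_τ - ρ ∂_ρ)/√2`: it is `((1+τ) dρ/dτ + ρ)/√2`, where `dρ/dτ = 2ρ⋆/(1-τ)²`. -/
def nullDensity (ρs τ : ℝ) : ℝ :=
  ((1 + τ) * (2 * ρs / (1 - τ) ^ 2) + 2 * ρs / (1 - τ)) / Real.sqrt 2

/-- `∑_{p'+q'+|α| ≤ m} ∫ |∂_ρ^{p'} ∂_τ^{q'} Z^α f|²` over the portion `-1 ≤ τ ≤ -1+ε` of the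
incoming null hypersurface `ρ = 2ρ⋆/(1-τ)`, with respect to the measure induced by `dv`. -/
def nullDataSq (m : ℕ) (ρs ε : ℝ) (f : Pt → ℂ) : ℝ≥0∞ :=
  ∑ i ∈ multiIndices m, ∫⁻ y in Set.Icc (-1) (-1 + ε) ×ˢ (Set.univ : Set SU2),
    ‖D i.1 i.2.1 i.2.2 f (y.1, 2 * ρs / (1 - y.1), y.2)‖ₑ ^ 2
      * ENNReal.ofReal (nullDensity ρs y.1) ∂((volume : Measure ℝ).prod haarSU2)

end FriedrichCylinder

end

open FriedrichCylinder

/-! The combinations `ψ₁ ± ½ψ` decouple the transport equations into the pairs `(ψ₂, ψ₁ + ½ψ)` and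
`(ψ₁ - ½ψ, ψ₀)`. Each pair `(f, g)` solves a symmetric hyperbolic system
`((1+τ)∂_τ - ρ∂_ρ) f = X₋ g - κ f`, `((1-τ)∂_τ + ρ∂_ρ) g = X₊ f + κ' g` with `κ, κ' ∈ {0, 1}`.
Commuting `∂_ρ^P ∂_τ^N Z^α` with the first operator adds the damping term `-(N - P) f`. If
`P = p' + p` and `N = q' + q` with `p' ≤ m`, then `m + p < q` makes the damping rate `N - P + κ` at
least `1`, although the operator degenerates at `τ = -1`; the commutators with `X_±` involve only
angular derivatives of no higher order. The damping controls the first field in the bulk, and an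
exponential weight in `τ` controls the second.

The energy identity is integrated in the variables `τ` and `s = ρ(1-τ)/2`, in which the domain is
the box `-1 ≤ τ ≤ -1+ε`, `0 ≤ s ≤ ρ⋆`. Since the fields are regular only for `ρ > 0`, the box is
exhausted by the boxes `s ≥ c` with `c → 0`; the flux through the face `s = c` has a favourable
sign. -/

noncomputable section

namespace FriedrichCylinder

/-! ### The frame `∂_τ, ∂_ρ, Z₁, Z₂, Z₃` -/

/-- The vector space `ℝ × ℝ × M₂(ℂ)` into which `ambient` embeds `ℝ × ℝ × SU(2)`. -/
abbrev Amb : Type := ℝ × ℝ × (Fin 2 → Fin 2 → ℂ)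

/-- The labels of the frame fields `∂_τ`, `∂_ρ` and `Zₖ`. -/
inductive Dir
  | tau
  | rho
  | ang (k : Fin 3)

/-- The integral curve of a frame field through `x`; it passes through `x` at the parameter
`Dir.base`, so that `dTau`, `dRho` and `Z k` are definitionally derivatives along it. -/
def Dir.curve : Dir → Pt → ℝ → Pt
  | .tau, x, t => (t, x.2.1, x.2.2)
  | .rho, x, t => (x.1, t, x.2.2)
  | .ang k, x, t => (x.1, x.2.1, x.2.2 * rot k t)

/-- The parameter at which `Dir.curve` passes through `x`. -/
def Dir.base : Dir → Pt → ℝ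
  | .tau, x => x.1
  | .rho, x => x.2.1
  | .ang _, _ => 0

/-- The derivative of `f` along a frame field. -/
def frameDeriv (d : Dir) (f : Pt → ℂ) : Pt → ℂ :=
  fun x => deriv (fun t => f (d.curve x t)) (d.base x)

theorem frameDeriv_tau : frameDeriv .tau = dTau := rfl

theorem frameDeriv_rho : frameDeriv .rho = dRho := rfl

theorem frameDeriv_ang (k : Fin 3) : frameDeriv (.ang k) = Z k := rfl

theorem rot_zero (k : Fin 3) : rot k 0 = 1 :=
  Subtype.ext (by simp [rot, rotMatrix])

theorem continuous_rot (k : Fin 3) : Continuous (rot k) := by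
  refine Continuous.subtype_mk (f := rotMatrix k) ?_ _
  unfold rotMatrix
  fun_prop

theorem Dir.curve_base (d : Dir) (x : Pt) : d.curve x (d.base x) = x := by
  cases d <;> simp [Dir.curve, Dir.base, rot_zero]

theorem Dir.continuous_curve (d : Dir) (x : Pt) : Continuous (d.curve x) := by
  have := continuous_rot
  cases d <;> unfold Dir.curve <;> fun_prop

theorem Dir.tendsto_curve (d : Dir) (x : Pt) :
    Filter.Tendsto (d.curve x) (𝓝 (d.base x)) (𝓝 x) := by
  simpa only [d.curve_base] using (d.continuous_curve x).tendsto (d.base x)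

/-- The generator `uₖ = -(i/2) σₖ` of `rot k`. -/
def gen (k : Fin 3) : Matrix (Fin 2) (Fin 2) ℂ := (-(Complex.I / 2)) • pauli k

/-- Right multiplication by a matrix, on the coordinate space underlying `M₂(ℂ)`. -/
def rmul (u : Matrix (Fin 2) (Fin 2) ℂ) : (Fin 2 → Fin 2 → ℂ) →L[ℝ] (Fin 2 → Fin 2 → ℂ) :=
  LinearMap.toContinuousLinearMap (mulRightLinearMap (Fin 2) ℝ u)

theorem rmul_apply (u : Matrix (Fin 2) (Fin 2) ℂ) (M : Fin 2 → Fin 2 → ℂ) :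
    rmul u M = fun i j => ∑ l, M i l * u l j := rfl

/-- The linear part of the affine vector field on `Amb` that restricts to a frame field. -/
def Dir.linPart : Dir → Amb →L[ℝ] Amb
  | .tau => 0
  | .rho => 0
  | .ang k => (0 : Amb →L[ℝ] ℝ).prod ((0 : Amb →L[ℝ] ℝ).prod
      (rmul (gen k) ∘L ContinuousLinearMap.snd ℝ ℝ _ ∘L ContinuousLinearMap.snd ℝ ℝ _))

/-- The constant part of the affine vector field on `Amb` that restricts to a frame field. -/
def Dir.constPart : Dir → Amb
  | .tau => (1, 0, 0)
  | .rho => (0, 1, 0)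
  | .ang _ => 0

theorem continuous_ambient : Continuous ambient := by
  have h : Continuous fun x : Pt => (x.2.2 : Matrix (Fin 2) (Fin 2) ℂ) := by fun_prop
  exact continuous_fst.prodMk ((continuous_fst.comp continuous_snd).prodMk h)

theorem hasDerivAt_rotMatrix_zero (k : Fin 3) (i j : Fin 2) :
    HasDerivAt (fun t => rotMatrix k t i j) (gen k i j) 0 := by
  have hhalf : HasDerivAt (fun t : ℝ => t / 2) (1 / 2) 0 := (hasDerivAt_id _).div_const 2
  have hrot := (hhalf.cos.ofReal_comp.mul_const ((1 : Matrix (Fin 2) (Fin 2) ℂ) i j)).sub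
    ((hhalf.sin.ofReal_comp.const_mul Complex.I).mul_const (pauli k i j))
  refine hrot.congr_deriv ?_
  simp only [gen, Matrix.smul_apply, smul_eq_mul, zero_div, Real.sin_zero, Real.cos_zero]
  push_cast
  ring

theorem Dir.hasDerivAt_ambient (d : Dir) (x : Pt) :
    HasDerivAt (fun t => ambient (d.curve x t)) (d.constPart + d.linPart (ambient x))
      (d.base x) := by
  cases d with
  | tau =>
    refine ((hasDerivAt_id x.1).prodMk (hasDerivAt_const x.1
      ((x.2.1, fun i j => x.2.2.1 i j) : ℝ × (Fin 2 → Fin 2 → ℂ)))).congr_deriv ?_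
    simp [Dir.constPart, Dir.linPart, Prod.zero_eq_mk]
  | rho =>
    refine ((hasDerivAt_const x.2.1 x.1).prodMk ((hasDerivAt_id x.2.1).prodMk
      (hasDerivAt_const x.2.1 (fun i j => x.2.2.1 i j : Fin 2 → Fin 2 → ℂ)))).congr_deriv ?_
    simp [Dir.constPart, Dir.linPart]
  | ang k =>
    have hmul : HasDerivAt (fun t i j => (x.2.2 * rot k t).1 i j)
        (rmul (gen k) (fun i j => x.2.2.1 i j)) 0 := by
      refine hasDerivAt_pi.2 fun i => hasDerivAt_pi.2 fun j => ?_
      simp only [rmul_apply, Submonoid.coe_mul, Matrix.mul_apply]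
      exact HasDerivAt.fun_sum fun l _ => (hasDerivAt_rotMatrix_zero k l j).const_mul _
    refine ((hasDerivAt_const (0 : ℝ) x.1).prodMk
      ((hasDerivAt_const (0 : ℝ) x.2.1).prodMk hmul)).congr_deriv ?_
    simp [Dir.constPart, Dir.linPart, ambient]

/-! ### Functions of class `C^n` -/

namespace IsCkAt

variable {n : ℕ} {f g : Pt → ℂ} {x : Pt}

theorem congr (hf : IsCkAt n f x) (h : g =ᶠ[𝓝 x] f) : IsCkAt n g x :=
  let ⟨F, hF, hfF⟩ := hf
  ⟨F, hF, h.trans hfF⟩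

theorem of_le {m : ℕ} (hf : IsCkAt n f x) (h : m ≤ n) : IsCkAt m f x :=
  let ⟨F, hF, hfF⟩ := hf
  ⟨F, hF.of_le (mod_cast h), hfF⟩

theorem eventually (hf : IsCkAt n f x) : ∀ᶠ y in 𝓝 x, IsCkAt n f y := by
  obtain ⟨F, hF, hfF⟩ := hf
  filter_upwards [continuous_ambient.continuousAt.eventually (hF.eventually (by simp)),
    hfF.eventually_nhds] with y hFy hfFy
  exact ⟨F, hFy, hfFy⟩

theorem continuousAt (hf : IsCkAt n f x) : ContinuousAt f x :=
  let ⟨_, hF, hfF⟩ := hf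
  (hF.continuousAt.comp (f := ambient) continuous_ambient.continuousAt).congr
    (Filter.EventuallyEq.symm hfF)

theorem add (hf : IsCkAt n f x) (hg : IsCkAt n g x) : IsCkAt n (fun y => f y + g y) x := by
  obtain ⟨F, hF, hfF⟩ := hf
  obtain ⟨G, hG, hgG⟩ := hg
  exact ⟨fun e => F e + G e, hF.add hG, Filter.EventuallyEq.add hfF hgG⟩

theorem mul (hf : IsCkAt n f x) (hg : IsCkAt n g x) : IsCkAt n (fun y => f y * g y) x := by
  obtain ⟨F, hF, hfF⟩ := hf
  obtain ⟨G, hG, hgG⟩ := hg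
  exact ⟨fun e => F e * G e, hF.mul hG, Filter.EventuallyEq.mul hfF hgG⟩

theorem conj (hf : IsCkAt n f x) : IsCkAt n (fun y => (starRingEnd ℂ) (f y)) x := by
  obtain ⟨F, hF, hfF⟩ := hf
  exact ⟨fun e => (starRingEnd ℂ) (F e), Complex.conjCLE.contDiff.contDiffAt.comp _ hF,
    Filter.EventuallyEq.fun_comp hfF _⟩

theorem of_coord {φ : ℝ × ℝ → ℂ} (hφ : ContDiffAt ℝ n φ (x.1, x.2.1)) :
    IsCkAt n (fun y => φ (y.1, y.2.1)) x :=
  ⟨fun e => φ (e.1, e.2.1), hφ.comp (ambient x) (f := fun e : Amb => (e.1, e.2.1))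
    (contDiff_fst.prodMk (contDiff_fst.comp contDiff_snd)).contDiffAt, .of_forall fun _ => rfl⟩

theorem const (c : ℂ) : IsCkAt n (fun _ => c) x :=
  of_coord (φ := fun _ => c) contDiffAt_const

theorem const_mul (hf : IsCkAt n f x) (c : ℂ) : IsCkAt n (fun y => c * f y) x :=
  (const c).mul hf

theorem sub (hf : IsCkAt n f x) (hg : IsCkAt n g x) : IsCkAt n (fun y => f y - g y) x :=
  (hf.add (hg.const_mul (-1))).congr (.of_forall fun y => by ring)

theorem sum {ι : Type*} {s : Finset ι} {f : ι → Pt → ℂ} (hf : ∀ i ∈ s, IsCkAt n (f i) x) :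
    IsCkAt n (fun y => ∑ i ∈ s, f i y) x := by
  choose! F hF hfF using hf
  refine ⟨fun e => ∑ i ∈ s, F i e, ContDiffAt.sum hF, ?_⟩
  filter_upwards [(Filter.eventually_all_finset s).2 hfF] with y hy
  exact Finset.sum_congr rfl hy

end IsCkAt

theorem hasDerivAt_comp_curve {F : Amb → ℂ} {f : Pt → ℂ} {x : Pt}
    (hF : DifferentiableAt ℝ F (ambient x)) (h : ∀ᶠ y in 𝓝 x, f y = F (ambient y)) (d : Dir) :
    HasDerivAt (fun t => f (d.curve x t))
      (fderiv ℝ F (ambient x) (d.constPart + d.linPart (ambient x))) (d.base x) := by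
  have hx : ambient x = ambient (d.curve x (d.base x)) := by rw [d.curve_base]
  exact (hF.hasFDerivAt.comp_hasDerivAt_of_eq (d.base x) (d.hasDerivAt_ambient x)
    hx).congr_of_eventuallyEq ((d.tendsto_curve x).eventually h)

theorem frameDeriv_eventuallyEq_fderiv {F : Amb → ℂ} {f : Pt → ℂ} {x : Pt}
    (hF : ContDiffAt ℝ 1 F (ambient x)) (h : ∀ᶠ y in 𝓝 x, f y = F (ambient y)) (d : Dir) :
    ∀ᶠ y in 𝓝 x,
      frameDeriv d f y = fderiv ℝ F (ambient y) (d.constPart + d.linPart (ambient y)) := by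
  filter_upwards [continuous_ambient.continuousAt.eventually (hF.eventually (by simp)),
    h.eventually_nhds] with y hFy hy
  exact (hasDerivAt_comp_curve (hFy.differentiableAt (by simp)) hy d).deriv

theorem contDiffAt_fderiv_frame {n : ℕ} {F : Amb → ℂ} {e : Amb}
    (hF : ContDiffAt ℝ (n + 1 : ℕ) F e) (d : Dir) :
    ContDiffAt ℝ n (fun e => fderiv ℝ F e (d.constPart + d.linPart e)) e :=
  (hF.fderiv_right (by simp)).clm_apply (contDiffAt_const.add d.linPart.contDiff.contDiffAt)

section FrameDeriv

variable {f g : Pt → ℂ} {x : Pt}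

theorem IsCkAt.differentiableAt (hf : IsCkAt 1 f x) (d : Dir) :
    DifferentiableAt ℝ (fun t => f (d.curve x t)) (d.base x) :=
  let ⟨_, hF, hfF⟩ := hf
  (hasDerivAt_comp_curve (hF.differentiableAt (by simp)) hfF d).differentiableAt

theorem IsCkAt.frameDeriv {n : ℕ} (hf : IsCkAt (n + 1) f x) (d : Dir) :
    IsCkAt n (frameDeriv d f) x :=
  let ⟨_, hF, hfF⟩ := hf
  ⟨_, contDiffAt_fderiv_frame hF d,
    frameDeriv_eventuallyEq_fderiv (hF.of_le (by simp)) hfF d⟩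

theorem frameDeriv_congr (h : f =ᶠ[𝓝 x] g) (d : Dir) :
    frameDeriv d f =ᶠ[𝓝 x] frameDeriv d g := by
  filter_upwards [h.eventually_nhds] with y hy
  exact Filter.EventuallyEq.deriv_eq ((d.tendsto_curve y).eventually hy)

theorem frameDeriv_mul (hf : IsCkAt 1 f x) (hg : IsCkAt 1 g x) (d : Dir) :
    frameDeriv d (fun y => f y * g y) =ᶠ[𝓝 x]
      fun y => frameDeriv d f y * g y + f y * frameDeriv d g y := by
  filter_upwards [hf.eventually, hg.eventually] with y hf hg
  simpa only [frameDeriv, d.curve_base] using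
    deriv_fun_mul (hf.differentiableAt d) (hg.differentiableAt d)

theorem frameDeriv_conj (hf : IsCkAt 1 f x) (d : Dir) :
    frameDeriv d (fun y => (starRingEnd ℂ) (f y)) =ᶠ[𝓝 x]
      fun y => (starRingEnd ℂ) (frameDeriv d f y) := by
  filter_upwards [hf.eventually] with y hf
  exact (Complex.conjCLE.hasFDerivAt.comp_hasDerivAt _ (hf.differentiableAt d).hasDerivAt).deriv

theorem frameDeriv_sub (hf : IsCkAt 1 f x) (hg : IsCkAt 1 g x) (d : Dir) :
    frameDeriv d (fun y => f y - g y) =ᶠ[𝓝 x] fun y => frameDeriv d f y - frameDeriv d g y := by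
  filter_upwards [hf.eventually, hg.eventually] with y hf hg
  exact deriv_fun_sub (hf.differentiableAt d) (hg.differentiableAt d)

theorem frameDeriv_sum_mul {ι : Type*} {s : Finset ι} {f : ι → Pt → ℂ} (c : ι → ℂ)
    (hf : ∀ i ∈ s, IsCkAt 1 (f i) x) (d : Dir) :
    frameDeriv d (fun y => ∑ i ∈ s, c i * f i y) =ᶠ[𝓝 x]
      fun y => ∑ i ∈ s, c i * frameDeriv d (f i) y := by
  filter_upwards [(Filter.eventually_all_finset s).2 fun i hi => (hf i hi).eventually] with y hy
  refine (deriv_fun_sum fun i hi => ((hy i hi).differentiableAt d).const_mul (c i)).trans ?_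
  exact Finset.sum_congr rfl fun i hi => deriv_const_mul _ ((hy i hi).differentiableAt d)

end FrameDeriv

/-! ### Commutators of the frame fields -/

theorem frameDeriv_frameDeriv_eventuallyEq {F : Amb → ℂ} {f : Pt → ℂ} {x : Pt}
    (hF : ContDiffAt ℝ 2 F (ambient x)) (h : ∀ᶠ y in 𝓝 x, f y = F (ambient y)) (d d' : Dir) :
    ∀ᶠ y in 𝓝 x, frameDeriv d (frameDeriv d' f) y =
      fderiv ℝ (fderiv ℝ F) (ambient y) (d.constPart + d.linPart (ambient y))
        (d'.constPart + d'.linPart (ambient y)) +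
      fderiv ℝ F (ambient y) (d'.linPart (d.constPart + d.linPart (ambient y))) := by
  have hF1 : ContDiffAt ℝ 1 F (ambient x) := hF.of_le (by norm_num)
  have hF' := contDiffAt_fderiv_frame (n := 1) (mod_cast hF) d'
  filter_upwards [frameDeriv_eventuallyEq_fderiv (mod_cast hF')
      (frameDeriv_eventuallyEq_fderiv hF1 h d') d,
    continuous_ambient.continuousAt.eventually (hF.eventually (by norm_num))] with y hy hFy
  have hFy' : DifferentiableAt ℝ (fderiv ℝ F) (ambient y) :=
    (hFy.fderiv_right (m := 1) (by norm_num)).differentiableAt (by simp)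
  rw [hy, (hFy'.hasFDerivAt.clm_apply (d'.linPart.hasFDerivAt.const_add d'.constPart)).fderiv]
  simp only [add_apply, ContinuousLinearMap.comp_apply, ContinuousLinearMap.flip_apply]
  ring

theorem frameDeriv_comm_eventuallyEq {F : Amb → ℂ} {f : Pt → ℂ} {x : Pt}
    (hF : ContDiffAt ℝ 2 F (ambient x)) (h : ∀ᶠ y in 𝓝 x, f y = F (ambient y)) (d d' : Dir) :
    ∀ᶠ y in 𝓝 x, frameDeriv d (frameDeriv d' f) y = frameDeriv d' (frameDeriv d f) y +
      fderiv ℝ F (ambient y) (d'.linPart (d.constPart + d.linPart (ambient y)) -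
        d.linPart (d'.constPart + d'.linPart (ambient y))) := by
  filter_upwards [frameDeriv_frameDeriv_eventuallyEq hF h d d',
    frameDeriv_frameDeriv_eventuallyEq hF h d' d,
    continuous_ambient.continuousAt.eventually (hF.eventually (by norm_num))] with y hdd' hd'd hFy
  have hsymm : IsSymmSndFDerivAt ℝ F (ambient y) := hFy.isSymmSndFDerivAt (by simp)
  rw [hdd', hd'd, hsymm.eq, map_sub]
  ring

/-- The structure constants `ϵₖₗⱼ` of `su(2)`. -/
def structConst : Fin 3 → Fin 3 → Fin 3 → ℝ :=
  ![![![0, 0, 0], ![0, 0, 1], ![0, -1, 0]],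
    ![![0, 0, -1], ![0, 0, 0], ![1, 0, 0]],
    ![![0, 1, 0], ![-1, 0, 0], ![0, 0, 0]]]

theorem gen_mul_gen_sub (k l : Fin 3) :
    gen k * gen l - gen l * gen k = ∑ j, structConst k l j • gen j := by
  have hI : Complex.I ^ 2 = -1 := Complex.I_sq
  ext a b
  fin_cases k <;> fin_cases l <;> fin_cases a <;> fin_cases b <;>
    simp [gen, pauli, structConst, Fin.sum_univ_succ] <;> grind

theorem rmul_comm_sub (k l : Fin 3) (M : Fin 2 → Fin 2 → ℂ) :
    rmul (gen l) (rmul (gen k) M) - rmul (gen k) (rmul (gen l) M) =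
      ∑ j, structConst k l j • rmul (gen j) M := by
  have hM := congrArg (fun u => Matrix.of M * u) (gen_mul_gen_sub k l)
  simp only [mul_sub, ← mul_assoc, Finset.mul_sum, Matrix.mul_smul] at hM
  funext a b
  simpa only [Matrix.sub_apply, Matrix.mul_apply, Matrix.sum_apply, Matrix.smul_apply,
    Matrix.of_apply, rmul_apply, Pi.sub_apply, Finset.sum_apply, Pi.smul_apply]
    using congrFun (congrFun hM a) b

theorem linPart_ang_comm_sub (k l : Fin 3) (e : Amb) :
    (Dir.ang l).linPart ((Dir.ang k).linPart e) - (Dir.ang k).linPart ((Dir.ang l).linPart e) =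
      ∑ j, structConst k l j • (Dir.ang j).linPart e := by
  refine Prod.ext ?_ (Prod.ext ?_ ?_)
  · simp [Dir.linPart, Prod.fst_sum]
  · simp [Dir.linPart, Prod.fst_sum, Prod.snd_sum]
  · simpa [Dir.linPart, Prod.snd_sum] using rmul_comm_sub k l e.2.2

theorem frameDeriv_ang_comm {f : Pt → ℂ} {x : Pt} (hf : IsCkAt 2 f x) (k l : Fin 3) :
    frameDeriv (.ang k) (frameDeriv (.ang l) f) =ᶠ[𝓝 x] fun y =>
      frameDeriv (.ang l) (frameDeriv (.ang k) f) y +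
        ∑ j, (structConst k l j : ℂ) * frameDeriv (.ang j) f y := by
  obtain ⟨F, hF, hfF⟩ := hf
  have hZ : ∀ᶠ y in 𝓝 x, ∀ j, frameDeriv (.ang j) f y =
      fderiv ℝ F (ambient y) ((Dir.ang j).constPart + (Dir.ang j).linPart (ambient y)) :=
    Filter.eventually_all.2 fun j =>
      frameDeriv_eventuallyEq_fderiv (hF.of_le (by norm_num)) hfF (.ang j)
  filter_upwards [frameDeriv_comm_eventuallyEq hF hfF (.ang k) (.ang l), hZ] with y hcomm hZ
  simp only [Dir.constPart, zero_add] at hcomm hZ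
  simp only [hcomm, linPart_ang_comm_sub, map_sum, map_smul, Complex.real_smul, hZ]

/-- The directions `∂_τ` and `∂_ρ`, whose fields commute with the whole frame. -/
def Dir.IsCoord : Dir → Prop
  | .ang _ => False
  | _ => True

theorem frameDeriv_comm_of_isCoord {f : Pt → ℂ} {x : Pt} (hf : IsCkAt 2 f x) {d : Dir}
    (hd : d.IsCoord) (d' : Dir) :
    frameDeriv d (frameDeriv d' f) =ᶠ[𝓝 x] frameDeriv d' (frameDeriv d f) := by
  obtain ⟨F, hF, hfF⟩ := hf
  filter_upwards [frameDeriv_comm_eventuallyEq hF hfF d d'] with y hcomm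
  have hbracket : d'.linPart (d.constPart + d.linPart (ambient y)) -
      d.linPart (d'.constPart + d'.linPart (ambient y)) = 0 := by
    cases d <;> cases d' <;> simp_all [Dir.IsCoord, Dir.linPart, Dir.constPart]
  rw [hcomm, hbracket, map_zero, add_zero]

/-! ### Words in the frame fields -/

/-- The composition of the frame derivatives listed in a word, the last letter acting first. -/
def wordDeriv (w : List Dir) (f : Pt → ℂ) : Pt → ℂ := w.foldr frameDeriv f

section WordDeriv

variable {f g : Pt → ℂ} {x : Pt}

theorem wordDeriv_cons (d : Dir) (w : List Dir) (f : Pt → ℂ) :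
    wordDeriv (d :: w) f = frameDeriv d (wordDeriv w f) := rfl

theorem wordDeriv_append (v w : List Dir) (f : Pt → ℂ) :
    wordDeriv (v ++ w) f = wordDeriv v (wordDeriv w f) := List.foldr_append

theorem wordDeriv_replicate (n : ℕ) (d : Dir) (f : Pt → ℂ) :
    wordDeriv (List.replicate n d) f = (frameDeriv d)^[n] f := by
  induction n with
  | zero => rfl
  | succ n ih => rw [List.replicate_succ, wordDeriv_cons, ih, Function.iterate_succ_apply']

theorem IsCkAt.wordDeriv {n : ℕ} {w : List Dir} (hf : IsCkAt (n + w.length) f x) :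
    IsCkAt n (wordDeriv w f) x := by
  induction w generalizing n with
  | nil => exact hf
  | cons d w ih =>
    exact (ih (n := n + 1) (hf.of_le (by rw [List.length_cons]; omega))).frameDeriv d

theorem wordDeriv_congr (h : f =ᶠ[𝓝 x] g) (w : List Dir) :
    wordDeriv w f =ᶠ[𝓝 x] wordDeriv w g := by
  induction w with
  | nil => exact h
  | cons d w ih => exact frameDeriv_congr ih d

theorem wordDeriv_sum_mul {ι : Type*} {s : Finset ι} {f : ι → Pt → ℂ} (c : ι → ℂ) {w : List Dir}
    (hf : ∀ i ∈ s, IsCkAt w.length (f i) x) :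
    wordDeriv w (fun y => ∑ i ∈ s, c i * f i y) =ᶠ[𝓝 x]
      fun y => ∑ i ∈ s, c i * wordDeriv w (f i) y := by
  induction w with
  | nil => rfl
  | cons d w ih =>
    refine (frameDeriv_congr (ih fun i hi => (hf i hi).of_le (by simp)) d).trans ?_
    exact frameDeriv_sum_mul c
      (fun i hi => ((hf i hi).of_le (by rw [List.length_cons, add_comm])).wordDeriv) d

theorem wordDeriv_mul_add_mul {w : List Dir} (hf : IsCkAt w.length f x)
    (hg : IsCkAt w.length g x) (s t : ℂ) :
    wordDeriv w (fun y => s * f y + t * g y) =ᶠ[𝓝 x]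
      fun y => s * wordDeriv w f y + t * wordDeriv w g y := by
  simpa only [Fin.sum_univ_two, Matrix.cons_val_zero, Matrix.cons_val_one] using
    wordDeriv_sum_mul (s := Finset.univ) (f := ![f, g]) ![s, t]
      (fun i _ => by fin_cases i; exacts [hf, hg])

theorem wordDeriv_frameDeriv_of_isCoord {d : Dir} (hd : d.IsCoord) {w : List Dir}
    (hf : IsCkAt (w.length + 1) f x) :
    wordDeriv w (frameDeriv d f) =ᶠ[𝓝 x] frameDeriv d (wordDeriv w f) := by
  induction w with
  | nil => rfl
  | cons d' w ih =>
    refine (frameDeriv_congr (ih (hf.of_le (by simp))) d').trans ?_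
    refine (frameDeriv_comm_of_isCoord (IsCkAt.wordDeriv (hf.of_le ?_)) hd d').symm
    rw [List.length_cons]
    omega

theorem wordDeriv_comm_of_isCoord {v w : List Dir} (hv : ∀ d ∈ v, d.IsCoord)
    (hf : IsCkAt (v.length + w.length) f x) :
    wordDeriv v (wordDeriv w f) =ᶠ[𝓝 x] wordDeriv w (wordDeriv v f) := by
  induction v with
  | nil => rfl
  | cons d v ih =>
    rw [List.forall_mem_cons] at hv
    rw [List.length_cons] at hf
    refine (frameDeriv_congr (ih hv.2 (hf.of_le (by omega))) d).trans ?_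
    exact (wordDeriv_frameDeriv_of_isCoord hv.1
      (IsCkAt.wordDeriv (hf.of_le (by omega)))).symm

end WordDeriv

/-! ### Reordering angular derivatives -/

/-- The composition of the fields `Zₖ` listed in a word, the last letter acting first. -/
def angDeriv (w : List (Fin 3)) : (Pt → ℂ) → Pt → ℂ := wordDeriv (w.map .ang)

/-- The order `|α|` of a multi-index. -/
def deg (α : ℕ × ℕ × ℕ) : ℕ := α.1 + α.2.1 + α.2.2

/-- The word `1^α₁ 2^α₂ 3^α₃` (with letters indexed from `0`) spelling the monomial `Z^α`. -/
def angWord (α : ℕ × ℕ × ℕ) : List (Fin 3) :=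
  List.replicate α.1 0 ++ List.replicate α.2.1 1 ++ List.replicate α.2.2 2

/-- The multi-indices of order at most `n`. -/
def angIdx (n : ℕ) : Finset (ℕ × ℕ × ℕ) :=
  (Finset.range (n + 1) ×ˢ Finset.range (n + 1) ×ˢ Finset.range (n + 1)).filter fun α => deg α ≤ n

theorem mem_angIdx {n : ℕ} {α : ℕ × ℕ × ℕ} : α ∈ angIdx n ↔ deg α ≤ n := by
  obtain ⟨a, b, c⟩ := α
  unfold angIdx
  rw [Finset.mem_filter]
  simp only [Finset.mem_product, Finset.mem_range, deg]
  omega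

theorem length_angWord (α : ℕ × ℕ × ℕ) : (angWord α).length = deg α := by
  simp [angWord, deg, add_assoc]

theorem ZPow_eq_angDeriv (α : ℕ × ℕ × ℕ) (f : Pt → ℂ) : ZPow α f = angDeriv (angWord α) f := by
  simp only [angDeriv, angWord, List.map_append, List.map_replicate, wordDeriv_append,
    wordDeriv_replicate, frameDeriv_ang, ZPow]

theorem perm_angWord (w : List (Fin 3)) : w.Perm (angWord (w.count 0, w.count 1, w.count 2)) := by
  rw [List.perm_iff_count]
  intro k
  fin_cases k <;> simp [angWord, List.count_replicate]

theorem angDeriv_cons (k : Fin 3) (w : List (Fin 3)) (f : Pt → ℂ) :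
    angDeriv (k :: w) f = frameDeriv (.ang k) (angDeriv w f) := rfl

theorem angDeriv_append (v w : List (Fin 3)) (f : Pt → ℂ) :
    angDeriv (v ++ w) f = angDeriv v (angDeriv w f) := by
  rw [angDeriv, List.map_append, wordDeriv_append]
  rfl

theorem IsCkAt.angDeriv {n : ℕ} {w : List (Fin 3)} {f : Pt → ℂ} {x : Pt}
    (hf : IsCkAt (n + w.length) f x) : IsCkAt n (angDeriv w f) x :=
  IsCkAt.wordDeriv (by rwa [List.length_map])

/-- On functions of class `C^(n+1)`, the operator `T` is a fixed linear combination of the ordered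
monomials `Z^α` with `|α| ≤ n`; the coefficients depend neither on the function nor on the point. -/
def Reduces (n : ℕ) (T : (Pt → ℂ) → Pt → ℂ) : Prop :=
  ∃ c : ℕ × ℕ × ℕ → ℂ, ∀ f x, IsCkAt (n + 1) f x →
    T f =ᶠ[𝓝 x] fun y => ∑ α ∈ angIdx n, c α * angDeriv (angWord α) f y

namespace Reduces

variable {n : ℕ} {T T' : (Pt → ℂ) → Pt → ℂ}

theorem mono {n' : ℕ} (h : Reduces n T) (hn : n ≤ n') : Reduces n' T := by
  obtain ⟨c, hc⟩ := h
  refine ⟨fun α => if α ∈ angIdx n then c α else 0, fun f x hf => ?_⟩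
  refine (hc f x (hf.of_le (by omega))).trans (.of_forall fun y => ?_)
  have hsub : angIdx n ⊆ angIdx n' := fun α hα => mem_angIdx.2 ((mem_angIdx.1 hα).trans hn)
  simp only [ite_mul, zero_mul, Finset.sum_ite_mem, Finset.inter_eq_right.2 hsub]

theorem congr (h : Reduces n T) (hT : ∀ f x, IsCkAt (n + 1) f x → T' f =ᶠ[𝓝 x] T f) :
    Reduces n T' :=
  let ⟨c, hc⟩ := h
  ⟨c, fun f x hf => (hT f x hf).trans (hc f x hf)⟩

theorem sum_mul {ι : Type*} {s : Finset ι} {T : ι → (Pt → ℂ) → Pt → ℂ} (a : ι → ℂ)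
    (h : ∀ i ∈ s, Reduces n (T i)) : Reduces n (fun f y => ∑ i ∈ s, a i * T i f y) := by
  choose! c hc using h
  refine ⟨fun α => ∑ i ∈ s, a i * c i α, fun f x hf => ?_⟩
  filter_upwards [(Filter.eventually_all_finset s).2 fun i hi => hc i hi f x hf] with y hy
  rw [Finset.sum_congr rfl fun i hi => by rw [hy i hi]]
  simp only [Finset.mul_sum, Finset.sum_mul, mul_assoc]
  exact Finset.sum_comm

theorem add (h : Reduces n T) (h' : Reduces n T') : Reduces n (fun f y => T f y + T' f y) :=
  (sum_mul (s := Finset.univ) (T := ![T, T']) ![1, 1]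
    (fun i _ => by fin_cases i; exacts [h, h'])).congr
    fun f _ _ => .of_forall fun y => by simp

theorem angDeriv_angWord {α : ℕ × ℕ × ℕ} (hα : deg α ≤ n) : Reduces n (angDeriv (angWord α)) :=
  ⟨fun β => if β = α then 1 else 0, fun f _ _ => .of_forall fun y => by
    simp [mem_angIdx.2 hα]⟩

theorem frameDeriv_ang (h : Reduces n T) (k : Fin 3)
    (hred : ∀ u : List (Fin 3), u.length ≤ n + 1 → Reduces u.length (angDeriv u)) :
    Reduces (n + 1) (fun f => frameDeriv (.ang k) (T f)) := by
  obtain ⟨c, hc⟩ := h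
  refine (sum_mul (T := fun α => angDeriv (k :: angWord α)) (s := angIdx n) c fun α hα => ?_).congr
    fun f x hf => ?_
  · have hlen : (k :: angWord α).length ≤ n + 1 := by
      simpa [length_angWord] using mem_angIdx.1 hα
    exact (hred _ hlen).mono hlen
  · refine (frameDeriv_congr (hc f x (hf.of_le (by omega))) _).trans
      (frameDeriv_sum_mul c (fun α hα => IsCkAt.angDeriv (hf.of_le ?_)) _)
    have := mem_angIdx.1 hα
    rw [length_angWord]
    omega

theorem angDeriv_swap_sub (k l : Fin 3) (u : List (Fin 3))
    (hred : ∀ v : List (Fin 3), v.length ≤ u.length + 1 → Reduces v.length (angDeriv v)) :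
    Reduces (u.length + 1)
      (fun f y => angDeriv (l :: k :: u) f y - angDeriv (k :: l :: u) f y) := by
  refine (sum_mul (s := Finset.univ) (T := fun j => angDeriv (j :: u))
    (fun j => (structConst l k j : ℂ)) fun j _ => hred (j :: u) le_rfl).congr fun f x hf => ?_
  have hu : IsCkAt 2 (angDeriv u f) x := IsCkAt.angDeriv (hf.of_le (Nat.add_comm 2 _).le)
  filter_upwards [frameDeriv_ang_comm hu l k] with y hy
  rw [angDeriv_cons, angDeriv_cons, hy, angDeriv_cons, angDeriv_cons]
  simp only [angDeriv_cons, add_sub_cancel_left]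

theorem angDeriv_sub_of_perm {v w : List (Fin 3)} (h : v.Perm w) {n : ℕ} (hn : v.length = n + 1)
    (hred : ∀ u : List (Fin 3), u.length ≤ n → Reduces u.length (angDeriv u)) :
    Reduces n (fun f y => angDeriv v f y - angDeriv w f y) := by
  induction h generalizing n with
  | nil => simp at hn
  | swap k l u =>
    obtain rfl : u.length + 1 = n := by simpa using hn
    exact angDeriv_swap_sub k l u hred
  | trans h _ ih ih' =>
    exact ((ih hn hred).add (ih' (h.length_eq ▸ hn) hred)).congr
      fun f _ _ => .of_forall fun y => (sub_add_sub_cancel _ _ _).symm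
  | @cons k v w h ih =>
    obtain rfl : v.length = n := by simpa using hn
    cases hv : v.length with
    | zero =>
      obtain rfl : v = [] := List.length_eq_zero_iff.1 hv
      obtain rfl : w = [] := h.nil_eq.symm
      exact ⟨0, fun f x _ => .of_forall fun y => by simp⟩
    | succ n =>
      rw [hv] at hred
      refine ((ih hv fun u hu => hred u (by omega)).frameDeriv_ang k hred).congr fun f x hf => ?_
      exact (frameDeriv_sub (IsCkAt.angDeriv (hf.of_le (by omega)))
        (IsCkAt.angDeriv (hf.of_le (by rw [← h.length_eq]; omega))) _).symm

end Reduces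

-- Poincaré-Birkhoff-Witt: sort the letters; each transposition only costs a shorter word.
theorem reduces_angDeriv (w : List (Fin 3)) : Reduces w.length (angDeriv w) := by
  induction hw : w.length using Nat.strong_induction_on generalizing w with
  | _ n ih =>
    have hsort := perm_angWord w
    have hdeg : deg (w.count 0, w.count 1, w.count 2) = w.length := by
      rw [← length_angWord, hsort.length_eq]
    have hmain := Reduces.angDeriv_angWord (n := n) (hdeg.trans hw).le
    cases n with
    | zero =>
      obtain rfl : w = [] := List.length_eq_zero_iff.1 hw
      exact hmain
    | succ n =>
      have hdiff := Reduces.angDeriv_sub_of_perm hsort hw fun u hu => ih _ (by omega) u rfl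
      exact ((hdiff.mono n.le_succ).add hmain).congr
        fun f _ _ => .of_forall fun y => (sub_add_cancel _ _).symm

theorem reduces_comm (k : Fin 3) (α : ℕ × ℕ × ℕ) :
    Reduces (deg α) fun f y =>
      angDeriv (angWord α) (frameDeriv (.ang k) f) y -
        frameDeriv (.ang k) (angDeriv (angWord α) f) y := by
  have hperm : (angWord α ++ [k]).Perm (k :: angWord α) := List.perm_append_singleton k _
  refine (Reduces.angDeriv_sub_of_perm hperm (by simp [length_angWord])
    fun u _ => reduces_angDeriv u).congr fun f x _ => .of_forall fun y => ?_
  rw [angDeriv_append]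
  rfl

/-! ### The derivatives `∂_ρ^P ∂_τ^N Z^α` -/

/-- The word spelling `∂_ρ^P ∂_τ^N`. -/
def coordWord (P N : ℕ) : List Dir := List.replicate P .rho ++ List.replicate N .tau

theorem length_coordWord (P N : ℕ) : (coordWord P N).length = P + N := by simp [coordWord]

theorem isCoord_of_mem_coordWord {P N : ℕ} {d : Dir} (hd : d ∈ coordWord P N) : d.IsCoord := by
  obtain ⟨-, rfl⟩ | ⟨-, rfl⟩ := by simpa [coordWord] using hd
  exacts [trivial, trivial]

theorem D_eq_wordDeriv (P N : ℕ) (α : ℕ × ℕ × ℕ) (f : Pt → ℂ) :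
    D P N α f = wordDeriv (coordWord P N) (angDeriv (angWord α) f) := by
  rw [coordWord, wordDeriv_append, wordDeriv_replicate, wordDeriv_replicate, frameDeriv_rho,
    frameDeriv_tau, ← ZPow_eq_angDeriv]
  rfl

section D

variable {n P N : ℕ} {α : ℕ × ℕ × ℕ} {f g : Pt → ℂ} {x : Pt}

theorem IsCkAt.D (hf : IsCkAt (n + (P + N + deg α)) f x) : IsCkAt n (D P N α f) x := by
  rw [D_eq_wordDeriv]
  exact IsCkAt.wordDeriv (IsCkAt.angDeriv (hf.of_le (by
    rw [length_coordWord, length_angWord, add_assoc])))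

theorem D_congr (h : f =ᶠ[𝓝 x] g) (P N : ℕ) (α : ℕ × ℕ × ℕ) : D P N α f =ᶠ[𝓝 x] D P N α g := by
  simp only [D_eq_wordDeriv]
  exact wordDeriv_congr (wordDeriv_congr h _) _

theorem D_mul_add_mul (hf : IsCkAt (P + N + deg α) f x) (hg : IsCkAt (P + N + deg α) g x)
    (s t : ℂ) :
    D P N α (fun y => s * f y + t * g y) =ᶠ[𝓝 x] fun y => s * D P N α f y + t * D P N α g y := by
  simp only [D_eq_wordDeriv, angDeriv, ← wordDeriv_append]
  refine wordDeriv_mul_add_mul ?_ ?_ s t <;>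
    simpa [length_coordWord, length_angWord]

theorem wordDeriv_eventuallyEq_of_perm {v w : List Dir} (h : v.Perm w) (hv : ∀ d ∈ v, d.IsCoord)
    (hf : IsCkAt v.length f x) : wordDeriv v f =ᶠ[𝓝 x] wordDeriv w f := by
  induction h with
  | nil => rfl
  | cons d _ ih =>
    rw [List.forall_mem_cons] at hv
    exact frameDeriv_congr (ih hv.2 (hf.of_le (by simp))) d
  | swap d d' u =>
    rw [List.forall_mem_cons] at hv
    exact frameDeriv_comm_of_isCoord
      (IsCkAt.wordDeriv (hf.of_le (by simp only [List.length_cons]; omega))) hv.1 d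
  | trans h _ ih ih' =>
    exact (ih hv hf).trans (ih' (fun d hd => hv d (h.mem_iff.2 hd)) (h.length_eq ▸ hf))

theorem D_wordDeriv_of_perm {p q : ℕ} {v : List Dir} (hv : v.Perm (coordWord p q))
    (hf : IsCkAt (P + N + deg α + (p + q)) f x) :
    D P N α (wordDeriv v f) =ᶠ[𝓝 x] D (P + p) (N + q) α f := by
  have hlen : v.length = p + q := hv.length_eq.trans (length_coordWord p q)
  have hcoord : ∀ d ∈ v, d.IsCoord := fun d hd => isCoord_of_mem_coordWord (hv.mem_iff.1 hd)
  have hperm : (coordWord P N ++ v).Perm (coordWord (P + p) (N + q)) := by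
    refine (hv.append_left _).trans ?_
    simp only [coordWord, List.replicate_add, List.append_assoc]
    exact (List.perm_append_comm_assoc _ _ _).append_left _
  rw [D_eq_wordDeriv, D_eq_wordDeriv]
  refine (wordDeriv_congr (wordDeriv_comm_of_isCoord hcoord (hf.of_le ?_)).symm _).trans ?_
  · simp only [List.length_map, length_angWord, hlen]
    omega
  · rw [← wordDeriv_append]
    refine wordDeriv_eventuallyEq_of_perm hperm ?_ (IsCkAt.angDeriv (hf.of_le ?_))
    · simpa only [List.forall_mem_append] using ⟨fun d => isCoord_of_mem_coordWord, hcoord⟩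
    · simp only [List.length_append, length_coordWord, length_angWord, hlen]
      omega

theorem D_dTau_dRho (p q : ℕ) (hf : IsCkAt (P + N + deg α + (p + q)) f x) :
    D P N α (dTau^[q] (dRho^[p] f)) =ᶠ[𝓝 x] D (P + p) (N + q) α f := by
  have h := D_wordDeriv_of_perm (v := List.replicate q .tau ++ List.replicate p .rho)
    List.perm_append_comm hf
  rwa [wordDeriv_append, wordDeriv_replicate, wordDeriv_replicate] at h

theorem D_dRho_dTau (p q : ℕ) (hf : IsCkAt (P + N + deg α + (p + q)) f x) :
    D P N α (dRho^[p] (dTau^[q] f)) =ᶠ[𝓝 x] D (P + p) (N + q) α f := by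
  have h := D_wordDeriv_of_perm (.refl (coordWord p q)) hf
  rwa [coordWord, wordDeriv_append, wordDeriv_replicate, wordDeriv_replicate] at h

end D

/-! ### Angular operators -/

/-- The left-invariant field `∑ₖ aₖ Zₖ` with complex coefficients; both `X₊` and `X₋` are of this
form. -/
def angOp (a : Fin 3 → ℂ) (f : Pt → ℂ) : Pt → ℂ := fun x => ∑ k, a k * Z k f x

theorem XPlus_eq_angOp : XPlus = angOp ![-Complex.I, -1, 0] := by
  funext f x
  simp only [XPlus, angOp, Fin.sum_univ_three, Matrix.cons_val]
  ring

theorem XMinus_eq_angOp : XMinus = angOp ![Complex.I, -1, 0] := by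
  funext f x
  simp only [XMinus, angOp, Fin.sum_univ_three, Matrix.cons_val]
  ring

section AngOp

variable {f g : Pt → ℂ} {x : Pt}

theorem IsCkAt.angOp {n : ℕ} (hf : IsCkAt (n + 1) f x) (a : Fin 3 → ℂ) :
    IsCkAt n (angOp a f) x :=
  IsCkAt.sum fun k _ => (hf.frameDeriv (.ang k)).const_mul (a k)

theorem angOp_mul_add_mul (hf : IsCkAt 1 f x) (hg : IsCkAt 1 g x) (a : Fin 3 → ℂ) (s t : ℂ) :
    angOp a (fun y => s * f y + t * g y) x = s * angOp a f x + t * angOp a g x := by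
  have hZ (k : Fin 3) : Z k (fun y => s * f y + t * g y) x = s * Z k f x + t * Z k g x :=
    (wordDeriv_mul_add_mul (w := [.ang k]) hf hg s t).self_of_nhds
  simp only [angOp, hZ, mul_add, Finset.sum_add_distrib, Finset.mul_sum, mul_left_comm]

theorem reduces_angDeriv_angOp (a : Fin 3 → ℂ) (α : ℕ × ℕ × ℕ) :
    Reduces (deg α) fun f y =>
      angDeriv (angWord α) (angOp a f) y - angOp a (angDeriv (angWord α) f) y := by
  refine (Reduces.sum_mul (s := Finset.univ) a fun k _ => reduces_comm k α).congr fun f x hf => ?_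
  have hsum := wordDeriv_sum_mul (s := Finset.univ) (f := fun k => Z k f) (x := x) a
    (w := (angWord α).map .ang) fun k _ =>
      (hf.of_le (by rw [List.length_map, length_angWord])).frameDeriv (.ang k)
  filter_upwards [hsum] with y hy
  simp only [mul_sub, Finset.sum_sub_distrib]
  exact congrArg (· - _) hy

theorem wordDeriv_angOp_of_isCoord (a : Fin 3 → ℂ) {v : List Dir} (hv : ∀ d ∈ v, d.IsCoord)
    (hf : IsCkAt (v.length + 1) f x) :
    wordDeriv v (angOp a f) =ᶠ[𝓝 x] angOp a (wordDeriv v f) := by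
  refine (wordDeriv_sum_mul a fun k _ => hf.frameDeriv (.ang k)).trans ?_
  have hcomm : ∀ᶠ y in 𝓝 x, ∀ k : Fin 3,
      wordDeriv v (frameDeriv (.ang k) f) y = frameDeriv (.ang k) (wordDeriv v f) y :=
    Filter.eventually_all.2 fun k => wordDeriv_comm_of_isCoord (w := [.ang k]) hv hf
  filter_upwards [hcomm] with y hy
  exact Finset.sum_congr rfl fun k _ => congrArg (a k * ·) (hy k)

theorem exists_D_angOp (a : Fin 3 → ℂ) (α : ℕ × ℕ × ℕ) : ∃ c : ℕ × ℕ × ℕ → ℂ, ∀ P N f x,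
    IsCkAt (P + N + deg α + 1) f x → D P N α (angOp a f) =ᶠ[𝓝 x]
      fun y => angOp a (D P N α f) y + ∑ β ∈ angIdx (deg α), c β * D P N β f y := by
  obtain ⟨c, hc⟩ := reduces_angDeriv_angOp a α
  refine ⟨c, fun P N f x hf => ?_⟩
  have hlen := length_coordWord P N
  have hα : IsCkAt (P + N + 1) (angDeriv (angWord α) f) x :=
    IsCkAt.angDeriv (hf.of_le (by rw [length_angWord]; omega))
  have hβ (β : ℕ × ℕ × ℕ) (h : β ∈ angIdx (deg α)) : IsCkAt (P + N) (angDeriv (angWord β) f) x :=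
    IsCkAt.angDeriv (hf.of_le (by rw [length_angWord]; have := mem_angIdx.1 h; omega))
  have hsplit : angDeriv (angWord α) (angOp a f) =ᶠ[𝓝 x] fun y =>
      1 * angOp a (angDeriv (angWord α) f) y +
        1 * ∑ β ∈ angIdx (deg α), c β * angDeriv (angWord β) f y := by
    filter_upwards [hc f x (hf.of_le (by omega))] with y hy
    rw [← hy]
    ring
  filter_upwards [wordDeriv_congr hsplit (coordWord P N),
    wordDeriv_mul_add_mul (w := coordWord P N) (hlen ▸ hα.angOp a)
      (hlen ▸ IsCkAt.sum fun β h => (hβ β h).const_mul (c β)) 1 1,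
    wordDeriv_angOp_of_isCoord a (fun _ => isCoord_of_mem_coordWord) (hlen ▸ hα),
    wordDeriv_sum_mul c (w := coordWord P N) fun β h => hlen ▸ hβ β h] with y h1 h2 h3 h4
  simp only [D_eq_wordDeriv]
  rw [h1, h2, h3, h4, one_mul, one_mul]

end AngOp

/-! ### The null derivatives -/

/-- The null derivatives `(1 + τ) ∂_τ - ρ ∂_ρ` (for `s = 1`) and `(1 - τ) ∂_τ + ρ ∂_ρ`
(for `s = -1`). -/
def nullDer (s : ℂ) (f : Pt → ℂ) : Pt → ℂ :=
  fun y => (1 + s * (y.1 : ℂ)) * dTau f y - s * (y.2.1 : ℂ) * dRho f y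

/-- The scaling weight of a field of the frame, which measures its failure to commute with the null
derivatives: `∂_τ` has weight `1`, `∂_ρ` has weight `-1` and the `Zₖ` have weight `0`. -/
def Dir.weight : Dir → ℂ
  | .tau => 1
  | .rho => -1
  | .ang _ => 0

section NullDer

variable {f g : Pt → ℂ} {x : Pt}

theorem isCkAt_tau (n : ℕ) (x : Pt) : IsCkAt n (fun y => (y.1 : ℂ)) x :=
  IsCkAt.of_coord (φ := fun p => (p.1 : ℂ))
    (Complex.ofRealCLM.contDiff.comp contDiff_fst).contDiffAt

theorem isCkAt_rho (n : ℕ) (x : Pt) : IsCkAt n (fun y => (y.2.1 : ℂ)) x :=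
  IsCkAt.of_coord (φ := fun p => (p.2 : ℂ))
    (Complex.ofRealCLM.contDiff.comp contDiff_snd).contDiffAt

theorem isCkAt_one_add_mul_tau (n : ℕ) (s : ℂ) : IsCkAt n (fun y => 1 + s * (y.1 : ℂ)) x :=
  (IsCkAt.const 1).add ((isCkAt_tau n x).const_mul s)

theorem IsCkAt.nullDer {n : ℕ} (hf : IsCkAt (n + 1) f x) (s : ℂ) : IsCkAt n (nullDer s f) x :=
  ((isCkAt_one_add_mul_tau n s).mul (hf.frameDeriv .tau)).sub
    (((isCkAt_rho n x).const_mul s).mul (hf.frameDeriv .rho))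

theorem frameDeriv_one_add_mul_tau (d : Dir) (s : ℂ) (y : Pt) :
    frameDeriv d (fun z => 1 + s * (z.1 : ℂ)) y = match d with | .tau => s | _ => 0 := by
  cases d with
  | tau =>
    exact (((hasDerivAt_id y.1).ofReal_comp.const_mul s).const_add 1).deriv.trans (by simp)
  | rho => simp [frameDeriv, Dir.curve]
  | ang k => simp [frameDeriv, Dir.curve]

theorem frameDeriv_mul_rho (d : Dir) (s : ℂ) (y : Pt) :
    frameDeriv d (fun z => s * (z.2.1 : ℂ)) y = match d with | .rho => s | _ => 0 := by
  cases d with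
  | tau => simp [frameDeriv, Dir.curve]
  | rho => exact ((hasDerivAt_id y.2.1).ofReal_comp.const_mul s).deriv.trans (by simp)
  | ang k => simp [frameDeriv, Dir.curve]

theorem frameDeriv_nullDer (d : Dir) (s : ℂ) (hf : IsCkAt 2 f x) :
    frameDeriv d (nullDer s f) =ᶠ[𝓝 x]
      fun y => nullDer s (frameDeriv d f) y + d.weight * s * frameDeriv d f y := by
  have hτ : IsCkAt 1 (fun y : Pt => 1 + s * (y.1 : ℂ)) x := isCkAt_one_add_mul_tau 1 s
  have hρ : IsCkAt 1 (fun y : Pt => s * (y.2.1 : ℂ)) x := (isCkAt_rho 1 x).const_mul s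
  filter_upwards [frameDeriv_sub (hτ.mul (hf.frameDeriv .tau)) (hρ.mul (hf.frameDeriv .rho)) d,
    frameDeriv_mul hτ (hf.frameDeriv .tau) d, frameDeriv_mul hρ (hf.frameDeriv .rho) d,
    frameDeriv_comm_of_isCoord (d := .tau) hf trivial d,
    frameDeriv_comm_of_isCoord (d := .rho) hf trivial d] with y hsub hmulτ hmulρ hcommτ hcommρ
  rw [frameDeriv_one_add_mul_tau] at hmulτ
  rw [frameDeriv_mul_rho] at hmulρ
  refine hsub.trans ?_
  rw [hmulτ, hmulρ, ← hcommτ, ← hcommρ]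
  cases d <;> simp only [nullDer, Dir.weight, frameDeriv_tau, frameDeriv_rho, frameDeriv_ang] <;>
    ring

theorem wordDeriv_nullDer (w : List Dir) (s : ℂ) (hf : IsCkAt (w.length + 1) f x) :
    wordDeriv w (nullDer s f) =ᶠ[𝓝 x]
      fun y => nullDer s (wordDeriv w f) y + (w.map Dir.weight).sum * s * wordDeriv w f y := by
  induction w with
  | nil => exact .of_forall fun y => by simp [wordDeriv]
  | cons d w ih =>
    have hw : IsCkAt 2 (wordDeriv w f) x :=
      IsCkAt.wordDeriv (hf.of_le (by rw [List.length_cons]; omega))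
    have hadd := wordDeriv_mul_add_mul (w := [d]) (hw.nullDer s) (hw.of_le one_le_two) 1
      ((w.map Dir.weight).sum * s)
    filter_upwards [frameDeriv_congr (ih (hf.of_le (by simp))) d, hadd,
      frameDeriv_nullDer d s hw] with y hind hadd hd
    simp only [one_mul] at hadd
    rw [wordDeriv_cons, hind, List.map_cons, List.sum_cons]
    have hsingle (h : Pt → ℂ) : wordDeriv [d] h = frameDeriv d h := rfl
    rw [hsingle, hsingle, hsingle, hd, ← wordDeriv_cons] at hadd
    rw [hadd]
    ring

theorem D_nullDer {P N : ℕ} {α : ℕ × ℕ × ℕ} (s : ℂ) (hf : IsCkAt (P + N + deg α + 1) f x) :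
    D P N α (nullDer s f) =ᶠ[𝓝 x]
      fun y => nullDer s (D P N α f) y + ((N : ℂ) - P) * s * D P N α f y := by
  have hweight : ((coordWord P N ++ (angWord α).map Dir.ang).map Dir.weight).sum = (N : ℂ) - P := by
    simp only [coordWord, List.append_assoc, List.map_append, List.map_replicate, Dir.weight,
      List.map_map, Function.comp_def, List.map_const', List.sum_append, List.sum_replicate,
      smul_neg, nsmul_eq_mul, mul_one]
    ring
  simp only [D_eq_wordDeriv, angDeriv, ← wordDeriv_append, ← hweight]
  exact wordDeriv_nullDer _ s (by simpa [length_coordWord, length_angWord])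

theorem nullDer_mul_add_mul (hf : IsCkAt 1 f x) (hg : IsCkAt 1 g x) (r s t : ℂ) :
    nullDer r (fun y => s * f y + t * g y) x = s * nullDer r f x + t * nullDer r g x := by
  have hτ : dTau (fun y => s * f y + t * g y) x = s * dTau f x + t * dTau g x :=
    (wordDeriv_mul_add_mul (w := [.tau]) hf hg s t).self_of_nhds
  have hρ : dRho (fun y => s * f y + t * g y) x = s * dRho f x + t * dRho g x :=
    (wordDeriv_mul_add_mul (w := [.rho]) hf hg s t).self_of_nhds
  rw [nullDer, hτ, hρ, nullDer, nullDer]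
  ring

theorem exists_nullDer_D (a : Fin 3 → ℂ) (α : ℕ × ℕ × ℕ) : ∃ c : ℕ × ℕ × ℕ → ℂ,
    ∀ (P N : ℕ) (s κ : ℂ) (f g : Pt → ℂ) (x : Pt), IsCkAt (P + N + deg α + 1) f x →
      IsCkAt (P + N + deg α + 1) g x → (∀ᶠ y in 𝓝 x, nullDer s g y = angOp a f y + κ * g y) →
      nullDer s (D P N α g) x = (κ - (N - P) * s) * D P N α g x + angOp a (D P N α f) x +
        ∑ β ∈ angIdx (deg α), c β * D P N β f x := by
  obtain ⟨c, hc⟩ := exists_D_angOp a α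
  refine ⟨c, fun P N s κ f g x hf hg heq => ?_⟩
  have heq' : nullDer s g =ᶠ[𝓝 x] fun y => 1 * angOp a f y + κ * g y := by
    filter_upwards [heq] with y hy
    rw [hy, one_mul]
  have hnull := (D_nullDer s hg).self_of_nhds
  have hlin := ((D_congr heq' P N α).trans
    (D_mul_add_mul (hf.angOp a) (hg.of_le (by omega)) 1 κ)).self_of_nhds
  have hang := (hc P N f x hf).self_of_nhds
  linear_combination hlin - hnull + hang

end NullDer

/-! ### The divergence theorem on boxes -/

instance : IsProbabilityMeasure haarSU2 :=
  ⟨Measure.haarMeasure_self⟩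

instance : haarSU2.IsHaarMeasure :=
  Measure.isHaarMeasure_haarMeasure ⊤

instance : IsFiniteMeasureOnCompacts dv := by
  unfold dv
  infer_instance

instance : SFinite dv := by
  unfold dv
  infer_instance

theorem map_mul_right_haarSU2 (g : SU2) : haarSU2.map (· * g) = haarSU2 := by
  have : IsProbabilityMeasure (haarSU2.map (· * g)) :=
    Measure.isProbabilityMeasure_map (measurable_mul_const g).aemeasurable
  exact Measure.isHaarMeasure_eq_of_isProbabilityMeasure _ _

theorem rot_add (k : Fin 3) (s t : ℝ) : rot k (s + t) = rot k s * rot k t := by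
  have hI : Complex.I ^ 2 = -1 := Complex.I_sq
  refine Subtype.ext ?_
  change rotMatrix k (s + t) = rotMatrix k s * rotMatrix k t
  ext i j
  unfold rotMatrix
  rw [add_div, Real.cos_add, Real.sin_add]
  fin_cases k <;> fin_cases i <;> fin_cases j <;>
    simp [pauli, Matrix.mul_apply, Fin.sum_univ_two] <;> grind

section Curve

variable {f : Pt → ℂ} {d : Dir} {x : Pt}

theorem Dir.curve_curve (d : Dir) (x : Pt) (s t : ℝ) :
    d.curve (d.curve x s) (d.base (d.curve x s) - s + t) = d.curve x t := by
  cases d <;> simp [Dir.curve, Dir.base, mul_assoc, ← rot_add]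

theorem hasDerivAt_curve {s : ℝ} (hf : IsCkAt 1 f (d.curve x s)) :
    HasDerivAt (fun t => f (d.curve x t)) (frameDeriv d f (d.curve x s)) s := by
  have h := (sub_add_cancel (d.base (d.curve x s)) s).symm ▸ (hf.differentiableAt d).hasDerivAt
  simpa only [d.curve_curve, sub_add_cancel, frameDeriv] using
    h.comp_const_add (d.base (d.curve x s) - s) s

theorem integral_frameDeriv_curve {a b : ℝ}
    (hf : ∀ t ∈ Set.uIcc a b, IsCkAt 1 f (d.curve x t)) :
    ∫ t in a..b, frameDeriv d f (d.curve x t) = f (d.curve x b) - f (d.curve x a) :=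
  intervalIntegral.integral_eq_sub_of_hasDerivAt (f := fun t => f (d.curve x t))
    (fun t ht => hasDerivAt_curve (hf t ht))
    (ContinuousOn.intervalIntegrable fun t ht =>
      (ContinuousAt.comp (f := d.curve x) ((hf t ht).frameDeriv (n := 0) d).continuousAt
        (d.continuous_curve x).continuousAt).continuousWithinAt)

end Curve

theorem integral_mul_right_haarSU2 (φ : SU2 → ℂ) (g : SU2) :
    ∫ h, φ (h * g) ∂haarSU2 = ∫ h, φ h ∂haarSU2 := by
  conv_rhs => rw [← map_mul_right_haarSU2 g]
  exact ((Homeomorph.mulRight g).measurableEmbedding.integral_map φ).symm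

theorem integrable_haarSU2 {φ : SU2 → ℂ} (hφ : Continuous φ) : Integrable φ haarSU2 :=
  integrableOn_univ.1 (hφ.continuousOn.integrableOn_compact isCompact_univ)

section Fiber

variable {f : Pt → ℂ} {τ ρ : ℝ}

theorem continuous_fiber {φ : Pt → ℂ} (hφ : ∀ g, ContinuousAt φ (τ, ρ, g)) :
    Continuous fun g => φ (τ, ρ, g) :=
  continuous_iff_continuousAt.2 fun g =>
    ContinuousAt.comp (f := fun g : SU2 => ((τ, ρ, g) : Pt)) (hφ g) (by fun_prop)

-- Average over the group the fundamental theorem of calculus along the orbits of `rot k`: the two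
-- end point terms agree by the right invariance of the Haar measure.
theorem integral_Z_fiber (hf : ∀ g, IsCkAt 1 f (τ, ρ, g)) (k : Fin 3) :
    ∫ g, Z k f (τ, ρ, g) ∂haarSU2 = 0 := by
  have hc : Continuous fun g => f (τ, ρ, g) := continuous_fiber fun g => (hf g).continuousAt
  have hZ : Continuous fun g => Z k f (τ, ρ, g) :=
    continuous_fiber fun g => ((hf g).frameDeriv (n := 0) (.ang k)).continuousAt
  have hftc (g : SU2) : ∫ s in (0 : ℝ)..1, Z k f (τ, ρ, g * rot k s) =
      f (τ, ρ, g * rot k 1) - f (τ, ρ, g) := by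
    simpa only [Dir.curve, frameDeriv_ang, rot_zero, mul_one] using
      integral_frameDeriv_curve (d := .ang k) (x := (τ, ρ, g)) (a := 0) (b := 1) fun s _ => hf _
  have hswap : ∫ s in (0 : ℝ)..1, ∫ g, Z k f (τ, ρ, g * rot k s) ∂haarSU2 =
      ∫ g, (∫ s in (0 : ℝ)..1, Z k f (τ, ρ, g * rot k s)) ∂haarSU2 :=
    intervalIntegral_integral_swap <| by
      rw [Set.uIoc_of_le zero_le_one, ← Measure.restrict_univ (μ := haarSU2), Measure.prod_restrict]
      refine IntegrableOn.mono_set (ContinuousOn.integrableOn_compact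
        (isCompact_Icc.prod isCompact_univ) (Continuous.continuousOn ?_))
        (Set.prod_mono_left Set.Ioc_subset_Icc_self)
      exact hZ.comp (continuous_snd.mul ((continuous_rot k).comp continuous_fst))
  calc ∫ g, Z k f (τ, ρ, g) ∂haarSU2
      = ∫ s in (0 : ℝ)..1, ∫ g, Z k f (τ, ρ, g * rot k s) ∂haarSU2 := by
        simp [integral_mul_right_haarSU2 fun g => Z k f (τ, ρ, g)]
    _ = ∫ g, f (τ, ρ, g * rot k 1) - f (τ, ρ, g) ∂haarSU2 := by simp only [hswap, hftc]
    _ = 0 := by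
        rw [integral_sub (integrable_haarSU2 (φ := fun g => f (τ, ρ, g * rot k 1))
          (hc.comp (continuous_mul_const _))) (integrable_haarSU2 hc),
          integral_mul_right_haarSU2 fun g => f (τ, ρ, g), sub_self]

end Fiber

/-- The product of two compact intervals and `SU(2)`. -/
def box (a b c d : ℝ) : Set Pt := Set.Icc a b ×ˢ Set.Icc c d ×ˢ Set.univ

/-- The product of a compact interval and `SU(2)`, which parametrizes the faces of a box. -/
abbrev slab (a b : ℝ) : Set (ℝ × SU2) := Set.Icc a b ×ˢ Set.univ

/-- The measure `dt dμ` on the faces of a box. -/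
abbrev slabMeasure : Measure (ℝ × SU2) := volume.prod haarSU2

theorem integrableOn_slab {E : Type*} [NormedAddCommGroup E] {f : Pt → E} {Φ : ℝ × SU2 → Pt}
    {a b : ℝ} (hf : ∀ y ∈ slab a b, ContinuousAt f (Φ y)) (hΦ : Continuous Φ) :
    IntegrableOn (fun y => f (Φ y)) (slab a b) slabMeasure :=
  ContinuousOn.integrableOn_compact (isCompact_Icc.prod isCompact_univ) fun y hy =>
    (ContinuousAt.comp (f := Φ) (hf y hy) hΦ.continuousAt).continuousWithinAt

section Box

variable {a b c d : ℝ}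

theorem mem_box {x : Pt} : x ∈ box a b c d ↔ x.1 ∈ Set.Icc a b ∧ x.2.1 ∈ Set.Icc c d := by
  simp only [box, Set.mem_prod, Set.mem_univ, and_true]

theorem integrableOn_box {E : Type*} [NormedAddCommGroup E] {f : Pt → E}
    (hf : ∀ x ∈ box a b c d, ContinuousAt f x) : IntegrableOn f (box a b c d) dv :=
  ContinuousOn.integrableOn_compact (isCompact_Icc.prod (isCompact_Icc.prod isCompact_univ))
    fun x hx => (hf x hx).continuousWithinAt

theorem ae_mem_interior_box (a b c d : ℝ) :
    ∀ᵐ x ∂(dv.restrict (box a b c d)), x.1 ∈ Set.Ioo a b ∧ x.2.1 ∈ Set.Ioo c d := by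
  have h : (Set.Ioo a b ×ˢ Set.Ioo c d ×ˢ (Set.univ : Set SU2) : Set Pt) =ᵐ[dv] box a b c d :=
    Measure.set_prod_ae_eq Ioo_ae_eq_Icc (Measure.set_prod_ae_eq Ioo_ae_eq_Icc .rfl)
  rw [← Measure.restrict_congr_set h]
  filter_upwards [ae_restrict_mem
    (measurableSet_Ioo.prod (measurableSet_Ioo.prod MeasurableSet.univ))] with x hx
  exact ⟨hx.1, hx.2.1⟩

section

variable {f : Pt → ℂ} (hf : ∀ x ∈ box a b c d, IsCkAt 1 f x)

include hf

theorem integrableOn_frameDeriv_box (e : Dir) : IntegrableOn (frameDeriv e f) (box a b c d) dv :=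
  integrableOn_box fun x hx => ((hf x hx).frameDeriv (n := 0) e).continuousAt

theorem integrableOn_frameDeriv_slab (e : Dir) {τ : ℝ} (hτ : τ ∈ Set.Icc a b) :
    IntegrableOn (fun y => frameDeriv e f (τ, y)) (slab c d) slabMeasure :=
  integrableOn_slab (fun y hy => ((hf (τ, y) ⟨hτ, hy⟩).frameDeriv (n := 0) e).continuousAt)
    (by fun_prop)

theorem integral_Z_box (k : Fin 3) : ∫ x in box a b c d, Z k f x ∂dv = 0 := by
  have hi := integrableOn_frameDeriv_box hf (.ang k)
  unfold box dv at *
  refine (setIntegral_prod _ hi).trans (setIntegral_eq_zero_of_forall_eq_zero fun τ hτ => ?_)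
  refine (setIntegral_prod _ (integrableOn_frameDeriv_slab hf (.ang k) hτ)).trans
    (setIntegral_eq_zero_of_forall_eq_zero fun ρ hρ => ?_)
  rw [Measure.restrict_univ]
  exact integral_Z_fiber (fun g => hf _ ⟨hτ, hρ, trivial⟩) k

theorem integral_angOp_box (z : Fin 3 → ℂ) : ∫ x in box a b c d, angOp z f x ∂dv = 0 := by
  simp only [angOp, ← frameDeriv_ang]
  rw [integral_finsetSum _ fun k _ => (integrableOn_frameDeriv_box hf (.ang k)).const_mul (z k)]
  simp only [integral_const_mul, frameDeriv_ang, integral_Z_box hf, mul_zero, Finset.sum_const_zero]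

theorem integral_dTau_box (hab : a ≤ b) : ∫ x in box a b c d, dTau f x ∂dv =
    ∫ y in slab c d, (f (b, y.1, y.2) - f (a, y.1, y.2)) ∂slabMeasure := by
  have hi := integrableOn_frameDeriv_box hf .tau
  unfold box dv at *
  rw [IntegrableOn, ← Measure.prod_restrict] at hi
  rw [← Measure.prod_restrict]
  refine (integral_prod_symm _ hi).trans
    (setIntegral_congr_fun (measurableSet_Icc.prod MeasurableSet.univ) fun y hy => ?_)
  rw [integral_Icc_eq_integral_Ioc, ← intervalIntegral.integral_of_le hab]
  refine integral_frameDeriv_curve (d := .tau) (x := (a, y)) fun t ht => ?_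
  rw [Set.uIcc_of_le hab] at ht
  exact hf _ ⟨ht, hy⟩

theorem integral_dRho_box (hcd : c ≤ d) : ∫ x in box a b c d, dRho f x ∂dv =
    ∫ y in slab a b, (f (y.1, d, y.2) - f (y.1, c, y.2)) ∂slabMeasure := by
  have hi := integrableOn_frameDeriv_box hf .rho
  have hc {e : ℝ} (he : e ∈ Set.Icc c d) :
      IntegrableOn (fun y => f (y.1, e, y.2)) (slab a b) slabMeasure :=
    integrableOn_slab (fun y hy => (hf (y.1, e, y.2) ⟨hy.1, he, trivial⟩).continuousAt)
      (by fun_prop)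
  rw [setIntegral_prod _ ((hc ⟨hcd, le_rfl⟩).sub' (hc ⟨le_rfl, hcd⟩))]
  unfold box dv at *
  refine (setIntegral_prod _ hi).trans (setIntegral_congr_fun measurableSet_Icc fun τ hτ => ?_)
  have hslab := integrableOn_frameDeriv_slab hf .rho hτ
  rw [IntegrableOn, ← Measure.prod_restrict] at hslab
  rw [← Measure.prod_restrict]
  refine (integral_prod_symm _ hslab).trans (integral_congr_ae (.of_forall fun g => ?_))
  simp only
  rw [integral_Icc_eq_integral_Ioc, ← intervalIntegral.integral_of_le hcd]
  refine integral_frameDeriv_curve (d := .rho) (x := (τ, c, g)) fun t ht => ?_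
  rw [Set.uIcc_of_le hcd] at ht
  exact hf _ ⟨hτ, ht, trivial⟩

end

section

variable {A B H : Pt → ℂ} (z : Fin 3 → ℂ) (hA : ∀ x ∈ box a b c d, IsCkAt 1 A x)
  (hB : ∀ x ∈ box a b c d, IsCkAt 1 B x) (hH : ∀ x ∈ box a b c d, IsCkAt 1 H x)

include hA hB hH

theorem integrableOn_divergence_box :
    IntegrableOn (fun x => dTau A x + dRho B x - angOp z H x) (box a b c d) dv :=
  ((integrableOn_frameDeriv_box hA .tau).add (integrableOn_frameDeriv_box hB .rho)).sub
    (integrableOn_box fun x hx => ((hH x hx).angOp (n := 0) z).continuousAt)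

theorem integral_divergence_box (hab : a ≤ b) (hcd : c ≤ d) :
    ∫ x in box a b c d, (dTau A x + dRho B x - angOp z H x) ∂dv =
      (∫ y in slab c d, (A (b, y.1, y.2) - A (a, y.1, y.2)) ∂slabMeasure) +
        ∫ y in slab a b, (B (y.1, d, y.2) - B (y.1, c, y.2)) ∂slabMeasure := by
  have hiA : IntegrableOn (dTau A) (box a b c d) dv := integrableOn_frameDeriv_box hA .tau
  have hiB : IntegrableOn (dRho B) (box a b c d) dv := integrableOn_frameDeriv_box hB .rho
  have hiAB : IntegrableOn (fun x => dTau A x + dRho B x) (box a b c d) dv := hiA.add hiB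
  have hiH : IntegrableOn (angOp z H) (box a b c d) dv :=
    integrableOn_box fun x hx => ((hH x hx).angOp (n := 0) z).continuousAt
  rw [integral_sub hiAB hiH, integral_add hiA hiB, integral_dTau_box hA hab,
    integral_dRho_box hB hcd, integral_angOp_box hH, sub_zero]

end

end Box

/-! ### The energy estimate on a box -/

/-- The exponential weight which absorbs zeroth order terms into the energy. -/
def expWeight (lam τ : ℝ) : ℝ := Real.exp (-lam * (τ + 1))

/-- The weight of `‖u‖²` in the flux through the hypersurfaces of constant `τ`. -/
def tauWeight (lam τ : ℝ) : ℝ := expWeight lam τ * ((1 + τ) * (1 - τ)⁻¹)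

/-- The weight of `ρ ‖u‖²` in the flux through the hypersurfaces of constant `ρ`; it is chosen such
that `tauWeight` and `rhoWeight` together have divergence `-lam * tauWeight`. -/
def rhoWeight (lam τ : ℝ) : ℝ := -(expWeight lam τ * (2 * (1 - τ)⁻¹ ^ 2))

/-- The weight of `u * conj w` in the flux in the directions tangent to `SU(2)`. -/
def angWeight (lam τ : ℝ) : ℝ := expWeight lam τ * (2 * (1 - τ)⁻¹)

/-- The energy density of the pair `(u, w)`: the component of its energy current along `∂_τ`. -/
def energyDensity (lam : ℝ) (u w : Pt → ℂ) (x : Pt) : ℝ :=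
  expWeight lam x.1 * ‖w x‖ ^ 2 + tauWeight lam x.1 * ‖u x‖ ^ 2

/-- The component along `∂_ρ` of the energy current of a pair `(u, w)`. -/
def radialFlux (lam : ℝ) (u : Pt → ℂ) (x : Pt) : ℝ := rhoWeight lam x.1 * (x.2.1 * ‖u x‖ ^ 2)

/-- The component along `X₊` of the energy current of a pair `(u, w)`; it is complex-valued since
`X₊` is a complex vector field. -/
def angFlux (lam : ℝ) (u w : Pt → ℂ) (x : Pt) : ℂ :=
  angWeight lam x.1 * (u x * (starRingEnd ℂ) (w x))

/-- The rate at which the pair `(u, w)` fails to solve the homogeneous system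
`(1 - τ) ∂_τ w = X₊ u`, `(1 + τ) ∂_τ u - 2 ρ (1 - τ)⁻¹ ∂_ρ u = X₋ w`, paired with `(u, w)`. -/
def boxSource (u w : Pt → ℂ) (x : Pt) : ℝ :=
  inner ℝ (w x) ((1 - (x.1 : ℂ)) * dTau w x - XPlus u x) +
    inner ℝ (u x) ((1 + (x.1 : ℂ)) * dTau u x - 2 * x.2.1 * (1 - (x.1 : ℂ))⁻¹ * dRho u x -
      XMinus w x)

section Weights

variable {lam τ : ℝ}

theorem expWeight_pos (lam τ : ℝ) : 0 < expWeight lam τ := Real.exp_pos _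

theorem expWeight_le_one (hlam : 0 ≤ lam) (hτ : -1 ≤ τ) : expWeight lam τ ≤ 1 :=
  Real.exp_le_one_iff.2 (by nlinarith)

theorem exp_neg_le_expWeight (hlam : 0 ≤ lam) (hτ : τ ≤ 0) :
    Real.exp (-lam) ≤ expWeight lam τ :=
  Real.exp_le_exp.2 (by nlinarith)

theorem tauWeight_nonneg (h₁ : -1 ≤ τ) (h₂ : τ ≤ 1) : 0 ≤ tauWeight lam τ :=
  mul_nonneg (expWeight_pos lam τ).le
    (mul_nonneg (by linarith) (inv_nonneg.2 (by linarith)))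

theorem hasDerivAt_expWeight (lam τ : ℝ) :
    HasDerivAt (expWeight lam) (-lam * expWeight lam τ) τ := by
  have h : HasDerivAt (fun t => -lam * (t + 1)) (-lam * 1) τ :=
    ((hasDerivAt_id τ).add_const 1).const_mul (-lam)
  exact h.exp.congr_deriv (by rw [mul_one, mul_comm, expWeight])

theorem hasDerivAt_tauWeight (lam : ℝ) (hτ : τ < 1) :
    HasDerivAt (tauWeight lam) (-lam * tauWeight lam τ - rhoWeight lam τ) τ := by
  have hne : 1 - τ ≠ 0 := by linarith
  have hinv : HasDerivAt (fun t : ℝ => (1 - t)⁻¹) (-(-1) / (1 - τ) ^ 2) τ :=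
    ((hasDerivAt_id τ).const_sub 1).fun_inv hne
  refine ((hasDerivAt_expWeight lam τ).mul
    (((hasDerivAt_id τ).const_add 1).mul hinv)).congr_deriv ?_
  simp only [id_eq, tauWeight, rhoWeight, Pi.mul_apply]
  field_simp
  ring

variable {n : ℕ}

theorem contDiffAt_expWeight : ContDiffAt ℝ n (expWeight lam) τ := by
  unfold expWeight
  fun_prop

theorem contDiffAt_inv_one_sub (hτ : τ < 1) : ContDiffAt ℝ n (fun t : ℝ => (1 - t)⁻¹) τ :=
  (contDiffAt_const.sub contDiffAt_id).inv (sub_pos.2 hτ).ne'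

theorem contDiffAt_tauWeight (hτ : τ < 1) : ContDiffAt ℝ n (tauWeight lam) τ :=
  contDiffAt_expWeight.mul
    ((contDiffAt_const.add contDiffAt_id).mul (contDiffAt_inv_one_sub hτ))

theorem contDiffAt_rhoWeight (hτ : τ < 1) : ContDiffAt ℝ n (rhoWeight lam) τ :=
  (contDiffAt_expWeight.mul (contDiffAt_const.mul ((contDiffAt_inv_one_sub hτ).pow 2))).neg

theorem contDiffAt_angWeight (hτ : τ < 1) : ContDiffAt ℝ n (angWeight lam) τ :=
  contDiffAt_expWeight.mul (contDiffAt_const.mul (contDiffAt_inv_one_sub hτ))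

end Weights

section Current

variable {lam : ℝ} {u w : Pt → ℂ} {x : Pt} {n : ℕ}

theorem IsCkAt.ofReal_comp_tau {φ : ℝ → ℝ} (h : ContDiffAt ℝ n φ x.1) :
    IsCkAt n (fun y => (φ y.1 : ℂ)) x :=
  IsCkAt.of_coord (φ := fun p => (φ p.1 : ℂ))
    (Complex.ofRealCLM.contDiff.contDiffAt.comp _ (h.comp (x.1, x.2.1) contDiffAt_fst))

theorem IsCkAt.continuousAt_of_ofReal {φ : Pt → ℝ} (h : IsCkAt n (fun y => (φ y : ℂ)) x) :
    ContinuousAt φ x :=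
  Complex.continuous_re.continuousAt.comp h.continuousAt

theorem IsCkAt.ofReal_norm_sq (hu : IsCkAt n u x) :
    IsCkAt n (fun y => ((‖u y‖ ^ 2 : ℝ) : ℂ)) x :=
  (hu.mul hu.conj).congr (.of_forall fun y => by
    simp only [Complex.mul_conj, Complex.normSq_eq_norm_sq])

theorem energyDensity_nonneg (h₁ : -1 ≤ x.1) (h₂ : x.1 ≤ 1) : 0 ≤ energyDensity lam u w x :=
  add_nonneg (mul_nonneg (expWeight_pos _ _).le (sq_nonneg _))
    (mul_nonneg (tauWeight_nonneg h₁ h₂) (sq_nonneg _))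

theorem energyDensity_neg_one (lam : ℝ) (u w : Pt → ℂ) (y : ℝ × SU2) :
    energyDensity lam u w (-1, y) = ‖w (-1, y)‖ ^ 2 := by
  simp [energyDensity, expWeight, tauWeight]

theorem radialFlux_nonpos (hx : 0 ≤ x.2.1) : radialFlux lam u x ≤ 0 := by
  have := expWeight_pos lam x.1
  simp only [radialFlux, rhoWeight, neg_mul, Left.neg_nonpos_iff]
  positivity

theorem neg_le_radialFlux (hlam : 0 ≤ lam) (hτ : -1 ≤ x.1) (hρ : 0 ≤ x.2.1) :
    -(2 * x.2.1 * (1 - x.1)⁻¹ ^ 2 * ‖u x‖ ^ 2) ≤ radialFlux lam u x :=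
  calc _ ≤ -(expWeight lam x.1 * (2 * x.2.1 * (1 - x.1)⁻¹ ^ 2 * ‖u x‖ ^ 2)) :=
        neg_le_neg (mul_le_of_le_one_left (by positivity) (expWeight_le_one hlam hτ))
    _ = _ := by simp only [radialFlux, rhoWeight]; ring

theorem isCkAt_energyDensity (hx : x.1 < 1) (hu : IsCkAt n u x) (hw : IsCkAt n w x) :
    IsCkAt n (fun y => (energyDensity lam u w y : ℂ)) x := by
  simp only [energyDensity, Complex.ofReal_add, Complex.ofReal_mul]
  exact ((IsCkAt.ofReal_comp_tau contDiffAt_expWeight).mul hw.ofReal_norm_sq).add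
    ((IsCkAt.ofReal_comp_tau (contDiffAt_tauWeight hx)).mul hu.ofReal_norm_sq)

theorem isCkAt_radialFlux (hx : x.1 < 1) (hu : IsCkAt n u x) :
    IsCkAt n (fun y => (radialFlux lam u y : ℂ)) x := by
  simp only [radialFlux, Complex.ofReal_mul]
  exact (IsCkAt.ofReal_comp_tau (contDiffAt_rhoWeight hx)).mul
    ((isCkAt_rho n x).mul hu.ofReal_norm_sq)

theorem isCkAt_angFlux (hx : x.1 < 1) (hu : IsCkAt n u x) (hw : IsCkAt n w x) :
    IsCkAt n (angFlux lam u w) x :=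
  (IsCkAt.ofReal_comp_tau (contDiffAt_angWeight hx)).mul (hu.mul hw.conj)

theorem continuousAt_boxSource (hx : x.1 < 1) (hu : IsCkAt 1 u x) (hw : IsCkAt 1 w x) :
    ContinuousAt (boxSource u w) x := by
  have hne : 1 - (x.1 : ℂ) ≠ 0 := mod_cast (sub_pos.2 hx).ne'
  have hu₀ := hu.continuousAt
  have hw₀ := hw.continuousAt
  have hτu : ContinuousAt (dTau u) x := (hu.frameDeriv (n := 0) .tau).continuousAt
  have hτw : ContinuousAt (dTau w) x := (hw.frameDeriv (n := 0) .tau).continuousAt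
  have hρu : ContinuousAt (dRho u) x := (hu.frameDeriv (n := 0) .rho).continuousAt
  have hXu : ContinuousAt (XPlus u) x := by
    rw [XPlus_eq_angOp]
    exact (hu.angOp (n := 0) _).continuousAt
  have hXw : ContinuousAt (XMinus w) x := by
    rw [XMinus_eq_angOp]
    exact (hw.angOp (n := 0) _).continuousAt
  unfold boxSource
  fun_prop (disch := exact hne)

theorem hasDerivAt_norm_sq_curve (hu : IsCkAt 1 u x) (d : Dir) :
    HasDerivAt (fun t => ‖u (d.curve x t)‖ ^ 2) (2 * inner ℝ (u x) (frameDeriv d u x))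
      (d.base x) := by
  simpa only [d.curve_base, frameDeriv] using (hu.differentiableAt d).hasDerivAt.norm_sq

theorem dTau_energyDensity (hx : x.1 < 1) (hu : IsCkAt 1 u x) (hw : IsCkAt 1 w x) :
    dTau (fun y => (energyDensity lam u w y : ℂ)) x =
      ((-lam * energyDensity lam u w x - rhoWeight lam x.1 * ‖u x‖ ^ 2 +
        2 * (expWeight lam x.1 * inner ℝ (w x) (dTau w x) +
          tauWeight lam x.1 * inner ℝ (u x) (dTau u x)) : ℝ) : ℂ) := by
  have h := ((hasDerivAt_expWeight lam x.1).mul (hasDerivAt_norm_sq_curve hw .tau)).add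
    ((hasDerivAt_tauWeight lam hx).mul (hasDerivAt_norm_sq_curve hu .tau))
  refine h.ofReal_comp.deriv.trans (congrArg _ ?_)
  simp only [Dir.curve, frameDeriv_tau, energyDensity]
  ring

theorem dRho_radialFlux (hu : IsCkAt 1 u x) :
    dRho (fun y => (radialFlux lam u y : ℂ)) x = ((rhoWeight lam x.1 *
      (‖u x‖ ^ 2 + x.2.1 * (2 * inner ℝ (u x) (dRho u x))) : ℝ) : ℂ) := by
  have h := ((hasDerivAt_id x.2.1).mul (hasDerivAt_norm_sq_curve hu .rho)).const_mul
    (rhoWeight lam x.1)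
  refine h.ofReal_comp.deriv.trans (congrArg _ ?_)
  simp only [Dir.curve, frameDeriv_rho, id_eq, one_mul]

theorem re_XPlus_angFlux (hu : IsCkAt 1 u x) (hw : IsCkAt 1 w x) :
    (XPlus (angFlux lam u w) x).re =
      angWeight lam x.1 * (inner ℝ (w x) (XPlus u x) + inner ℝ (u x) (XMinus w x)) := by
  have hconj (k : Fin 3) : Z k (fun y => (starRingEnd ℂ) (w y)) x = (starRingEnd ℂ) (Z k w x) :=
    (frameDeriv_conj hw (.ang k)).self_of_nhds
  have hZ (k : Fin 3) : Z k (angFlux lam u w) x = angWeight lam x.1 *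
      (Z k u x * (starRingEnd ℂ) (w x) + u x * (starRingEnd ℂ) (Z k w x)) := by
    have hmul : Z k (fun y => u y * (starRingEnd ℂ) (w y)) x =
        Z k u x * (starRingEnd ℂ) (w x) + u x * Z k (fun y => (starRingEnd ℂ) (w y)) x :=
      (frameDeriv_mul hu hw.conj (.ang k)).self_of_nhds
    rw [hconj] at hmul
    exact (deriv_const_mul (angWeight lam x.1 : ℂ)
      ((hu.mul hw.conj).differentiableAt (.ang k))).trans (congrArg _ hmul)
  simp only [XPlus, XMinus, hZ, Complex.inner, Complex.mul_re, Complex.mul_im, Complex.add_re,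
    Complex.add_im, Complex.neg_re, Complex.neg_im, Complex.sub_re, Complex.sub_im, Complex.I_re,
    Complex.I_im, Complex.conj_re, Complex.conj_im, Complex.ofReal_re, Complex.ofReal_im]
  ring

theorem re_divergence_energyCurrent (hx : x.1 < 1) (hu : IsCkAt 1 u x) (hw : IsCkAt 1 w x) :
    (dTau (fun y => (energyDensity lam u w y : ℂ)) x +
        dRho (fun y => (radialFlux lam u y : ℂ)) x - XPlus (angFlux lam u w) x).re =
      angWeight lam x.1 * boxSource u w x - lam * energyDensity lam u w x := by
  have hne : 1 - x.1 ≠ 0 := (sub_pos.2 hx).ne'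
  have hw' : ((1 : ℂ) - x.1) * dTau w x = (1 - x.1) • dTau w x := by simp
  have hu' : ((1 : ℂ) + x.1) * dTau u x = (1 + x.1) • dTau u x := by simp
  have hρ : 2 * (x.2.1 : ℂ) * (1 - (x.1 : ℂ))⁻¹ * dRho u x =
      (2 * x.2.1 * (1 - x.1)⁻¹) • dRho u x := by simp
  rw [dTau_energyDensity hx hu hw, dRho_radialFlux hu, Complex.sub_re, re_XPlus_angFlux hu hw,
    boxSource, hw', hu', hρ]
  simp only [inner_sub_right, real_inner_smul_right, Complex.add_re, Complex.ofReal_re,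
    tauWeight, rhoWeight, angWeight]
  field_simp
  ring

end Current

section Box

variable {lam T c d : ℝ} {u w : Pt → ℂ}

/-- The energy which a pair `(u, w)` carries into a box through its faces `τ = -1` and `ρ = d`. -/
def boxInflow (T c d : ℝ) (u w : Pt → ℂ) : ℝ :=
  (∫ y in slab c d, ‖w (-1, y.1, y.2)‖ ^ 2 ∂slabMeasure) +
    ∫ y in slab (-1) T, 2 * d * (1 - y.1)⁻¹ ^ 2 * ‖u (y.1, d, y.2)‖ ^ 2 ∂slabMeasure

theorem integral_energyCurrent (hT₁ : -1 ≤ T) (hT₀ : T ≤ 0) (hcd : c ≤ d)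
    (hu : ∀ x ∈ box (-1) T c d, IsCkAt 1 u x) (hw : ∀ x ∈ box (-1) T c d, IsCkAt 1 w x) :
    ∫ x in box (-1) T c d,
        (angWeight lam x.1 * boxSource u w x - lam * energyDensity lam u w x) ∂dv =
      (∫ y in slab c d,
        (energyDensity lam u w (T, y.1, y.2) - energyDensity lam u w (-1, y.1, y.2))
          ∂slabMeasure) +
      ∫ y in slab (-1) T, (radialFlux lam u (y.1, d, y.2) - radialFlux lam u (y.1, c, y.2))
        ∂slabMeasure := by
  have hlt {x : Pt} (hx : x ∈ box (-1) T c d) : x.1 < 1 := by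
    linarith [(mem_box.1 hx).1.2]
  have hE {x : Pt} (hx : x ∈ box (-1) T c d) :=
    isCkAt_energyDensity (lam := lam) (hlt hx) (hu x hx) (hw x hx)
  have hR {x : Pt} (hx : x ∈ box (-1) T c d) :=
    isCkAt_radialFlux (lam := lam) (hlt hx) (hu x hx)
  have hH {x : Pt} (hx : x ∈ box (-1) T c d) :=
    isCkAt_angFlux (lam := lam) (hlt hx) (hu x hx) (hw x hx)
  have hdiv := congrArg Complex.re (integral_divergence_box ![-Complex.I, -1, 0]
    (fun _ hx => hE hx) (fun _ hx => hR hx) (fun _ hx => hH hx) hT₁ hcd)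
  have hint := integrableOn_divergence_box ![-Complex.I, -1, 0]
    (fun _ hx => hE hx) (fun _ hx => hR hx) (fun _ hx => hH hx)
  simp only [← XPlus_eq_angOp, ← Complex.ofReal_sub, integral_complex_ofReal, Complex.add_re,
    Complex.ofReal_re] at hdiv hint
  rw [← hdiv]
  refine Eq.trans ?_ (integral_re hint)
  refine setIntegral_congr_fun
    (measurableSet_Icc.prod (measurableSet_Icc.prod MeasurableSet.univ)) fun x hx => ?_
  exact (re_divergence_energyCurrent (hlt hx) (hu x hx) (hw x hx)).symm

theorem neg_boxInflow_le (hlam : 0 ≤ lam) (hT₁ : -1 ≤ T) (hT₀ : T ≤ 0) (hc : 0 ≤ c) (hcd : c ≤ d)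
    (hu : ∀ x ∈ box (-1) T c d, IsCkAt 1 u x) (hw : ∀ x ∈ box (-1) T c d, IsCkAt 1 w x) :
    -boxInflow T c d u w ≤ ∫ x in box (-1) T c d,
      (angWeight lam x.1 * boxSource u w x - lam * energyDensity lam u w x) ∂dv := by
  have hlt {x : Pt} (hx : x ∈ box (-1) T c d) : x.1 < 1 := by
    linarith [(mem_box.1 hx).1.2]
  have hE {t : ℝ} (ht : t ∈ Set.Icc (-1) T) :
      IntegrableOn (fun y => energyDensity lam u w (t, y)) (slab c d) slabMeasure := by
    refine integrableOn_slab (Φ := fun y => (t, y)) (fun y hy => ?_) (by fun_prop)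
    have hy' : (t, y) ∈ box (-1) T c d := ⟨ht, hy⟩
    exact (isCkAt_energyDensity (hlt hy') (hu _ hy') (hw _ hy')).continuousAt_of_ofReal
  have hR {r : ℝ} (hr : r ∈ Set.Icc c d) :
      IntegrableOn (fun y => radialFlux lam u (y.1, r, y.2)) (slab (-1) T) slabMeasure := by
    refine integrableOn_slab (Φ := fun y => (y.1, r, y.2)) (fun y hy => ?_) (by fun_prop)
    have hy' : (y.1, r, y.2) ∈ box (-1) T c d := ⟨hy.1, hr, trivial⟩
    exact (isCkAt_radialFlux (hlt hy') (hu _ hy')).continuousAt_of_ofReal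
  have hD : IntegrableOn (fun y => 2 * d * (1 - y.1)⁻¹ ^ 2 * ‖u (y.1, d, y.2)‖ ^ 2)
      (slab (-1) T) slabMeasure := by
    refine integrableOn_slab (f := fun x => 2 * d * (1 - x.1)⁻¹ ^ 2 * ‖u x‖ ^ 2)
      (Φ := fun y => (y.1, d, y.2)) (fun y hy => ?_) (by fun_prop)
    have hy' : (y.1, d, y.2) ∈ box (-1) T c d := ⟨hy.1, ⟨hcd, le_rfl⟩, trivial⟩
    have hne : 1 - y.1 ≠ 0 := (sub_pos.2 (hlt hy')).ne'
    have := (hu _ hy').continuousAt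
    fun_prop (disch := exact hne)
  have hslab {a b : ℝ} : MeasurableSet (slab a b) := measurableSet_Icc.prod MeasurableSet.univ
  simp only [boxInflow, ← energyDensity_neg_one lam u w]
  rw [integral_energyCurrent hT₁ hT₀ hcd hu hw, neg_add, ← integral_neg, ← integral_neg]
  refine add_le_add
    (setIntegral_mono_on (hE ⟨le_rfl, hT₁⟩).neg ((hE ⟨hT₁, le_rfl⟩).sub (hE ⟨le_rfl, hT₁⟩)) hslab
      fun y _ => ?_)
    (setIntegral_mono_on hD.neg ((hR ⟨hcd, le_rfl⟩).sub (hR ⟨le_rfl, hcd⟩)) hslab fun y hy => ?_)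
  · have : 0 ≤ energyDensity lam u w (T, y) := energyDensity_nonneg hT₁ (by linarith)
    exact neg_le_sub_iff_le_add.2 (by linarith)
  · have h₁ := neg_le_radialFlux (u := u) (x := (y.1, d, y.2)) hlam hy.1.1 (hc.trans hcd)
    have h₂ := radialFlux_nonpos (lam := lam) (u := u) (x := (y.1, c, y.2)) hc
    exact h₁.trans (le_sub_self_iff _ |>.2 h₂)

theorem energyDensity_add_source_le {ι : Type*} (I : Finset ι) {u w : ι → Pt → ℂ} {K : ℝ}
    {x : Pt} (hK : 0 ≤ K) (hx₁ : -1 ≤ x.1) (hx₀ : x.1 ≤ 0)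
    (hsource : 2 * ∑ i ∈ I, boxSource (u i) (w i) x ≤
        (K - 1) * ∑ i ∈ I, ‖w i x‖ ^ 2 - ∑ i ∈ I, ‖u i x‖ ^ 2) :
    Real.exp (-K) * ((1 - x.1)⁻¹ * ∑ i ∈ I, (‖u i x‖ ^ 2 + ‖w i x‖ ^ 2)) ≤
      -∑ i ∈ I,
        (angWeight K x.1 * boxSource (u i) (w i) x - K * energyDensity K (u i) (w i) x) := by
  have hinv₀ : 0 ≤ (1 - x.1)⁻¹ := inv_nonneg.2 (by linarith)
  have hinv₁ : (1 - x.1)⁻¹ ≤ 1 := inv_le_one_of_one_le₀ (by linarith)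
  simp only [energyDensity, angWeight, tauWeight, Finset.sum_sub_distrib, Finset.sum_add_distrib,
    ← Finset.mul_sum]
  set U := ∑ i ∈ I, ‖u i x‖ ^ 2
  set W := ∑ i ∈ I, ‖w i x‖ ^ 2
  set B := ∑ i ∈ I, boxSource (u i) (w i) x
  have hU : 0 ≤ U := by positivity
  have hW : 0 ≤ W := by positivity
  have hexp := exp_neg_le_expWeight hK hx₀
  have hbracket : (1 - x.1)⁻¹ * (U + W) ≤
      K * (W + (1 + x.1) * (1 - x.1)⁻¹ * U) - (1 - x.1)⁻¹ * (2 * B) := by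
    have h₁ := mul_le_mul_of_nonneg_left hsource hinv₀
    have h₂ : K * W * (1 - x.1)⁻¹ ≤ K * W := mul_le_of_le_one_right (mul_nonneg hK hW) hinv₁
    have h₃ : 0 ≤ K * ((1 + x.1) * (1 - x.1)⁻¹ * U) :=
      mul_nonneg hK (mul_nonneg (mul_nonneg (by linarith) hinv₀) hU)
    linarith
  calc Real.exp (-K) * ((1 - x.1)⁻¹ * (U + W))
      ≤ expWeight K x.1 * ((1 - x.1)⁻¹ * (U + W)) := by gcongr
    _ ≤ expWeight K x.1 * (K * (W + (1 + x.1) * (1 - x.1)⁻¹ * U) - (1 - x.1)⁻¹ * (2 * B)) := by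
        gcongr
        exact (expWeight_pos _ _).le
    _ = _ := by ring

theorem integral_box_le_boxInflow {ι : Type*} (I : Finset ι) {u w : ι → Pt → ℂ} {K : ℝ}
    (hK : 0 ≤ K) (hT₁ : -1 ≤ T) (hT₀ : T ≤ 0) (hc : 0 ≤ c) (hcd : c ≤ d)
    (hu : ∀ i ∈ I, ∀ x ∈ box (-1) T c d, IsCkAt 1 (u i) x)
    (hw : ∀ i ∈ I, ∀ x ∈ box (-1) T c d, IsCkAt 1 (w i) x)
    (hsource : ∀ x : Pt, x.1 ∈ Set.Ioo (-1) T → x.2.1 ∈ Set.Ioo c d →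
      2 * ∑ i ∈ I, boxSource (u i) (w i) x ≤
        (K - 1) * ∑ i ∈ I, ‖w i x‖ ^ 2 - ∑ i ∈ I, ‖u i x‖ ^ 2) :
    ∫ x in box (-1) T c d, (1 - x.1)⁻¹ * ∑ i ∈ I, (‖u i x‖ ^ 2 + ‖w i x‖ ^ 2) ∂dv ≤
      Real.exp K * ∑ i ∈ I, boxInflow T c d (u i) (w i) := by
  have hlt {x : Pt} (hx : x ∈ box (-1) T c d) : x.1 < 1 := by
    linarith [(mem_box.1 hx).1.2]
  have hS (i : ι) (hi : i ∈ I) : IntegrableOn (fun x => angWeight K x.1 * boxSource (u i) (w i) x -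
      K * energyDensity K (u i) (w i) x) (box (-1) T c d) dv := by
    refine integrableOn_box fun x hx => ?_
    have h₁ := (IsCkAt.ofReal_comp_tau (n := 0)
      (contDiffAt_angWeight (lam := K) (hlt hx))).continuousAt_of_ofReal
    have h₂ := continuousAt_boxSource (hlt hx) (hu i hi x hx) (hw i hi x hx)
    have h₃ := (isCkAt_energyDensity (lam := K) (hlt hx) (hu i hi x hx)
      (hw i hi x hx)).continuousAt_of_ofReal
    exact (h₁.mul h₂).sub (h₃.const_mul K)
  have hN : IntegrableOn (fun x => (1 - x.1)⁻¹ * ∑ i ∈ I, (‖u i x‖ ^ 2 + ‖w i x‖ ^ 2))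
      (box (-1) T c d) dv := by
    refine integrableOn_box fun x hx => ?_
    have hne : 1 - x.1 ≠ 0 := (sub_pos.2 (hlt hx)).ne'
    have hsum : ContinuousAt (fun y => ∑ i ∈ I, (‖u i y‖ ^ 2 + ‖w i y‖ ^ 2)) x :=
      tendsto_finsetSum _ fun i hi => ((hu i hi x hx).continuousAt.norm.pow 2).add
        ((hw i hi x hx).continuousAt.norm.pow 2)
    exact ((continuousAt_const.sub continuousAt_fst).inv₀ hne).mul hsum
  have hle : Real.exp (-K) *
      ∫ x in box (-1) T c d, (1 - x.1)⁻¹ * ∑ i ∈ I, (‖u i x‖ ^ 2 + ‖w i x‖ ^ 2) ∂dv ≤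
        ∑ i ∈ I, boxInflow T c d (u i) (w i) := by
    calc _ ≤ ∫ x in box (-1) T c d, -∑ i ∈ I, (angWeight K x.1 * boxSource (u i) (w i) x -
              K * energyDensity K (u i) (w i) x) ∂dv := by
            rw [← integral_const_mul]
            refine integral_mono_ae (hN.const_mul _) (integrable_finsetSum _ hS).neg ?_
            filter_upwards [ae_mem_interior_box (-1) T c d] with x hx
            exact energyDensity_add_source_le I hK hx.1.1.le (hx.1.2.le.trans hT₀)
              (hsource x hx.1 hx.2)
      _ ≤ _ := by
            rw [integral_neg, integral_finsetSum _ hS, ← Finset.sum_neg_distrib]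
            exact Finset.sum_le_sum fun i hi =>
              neg_le.1 (neg_boxInflow_le hK hT₁ hT₀ hc hcd (hu i hi) (hw i hi))
  rwa [Real.exp_neg, inv_mul_le_iff₀ (Real.exp_pos K)] at hle

end Box

/-! ### Straightening the outgoing characteristics -/

/-- The map `(τ, s, g) ↦ (τ, 2s/(1-τ), g)`, which takes lines parallel to the `τ`-axis to the
integral curves of `(1 - τ) ∂_τ + ρ ∂_ρ` and thereby boxes to wedges bounded by such curves. -/
def straight (x : Pt) : Pt := (x.1, 2 * x.2.1 * (1 - x.1)⁻¹, x.2.2)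

section Straight

variable {f : Pt → ℂ} {x : Pt}

theorem continuousAt_straight (hx : x.1 < 1) : ContinuousAt straight x := by
  have hne : 1 - x.1 ≠ 0 := (sub_pos.2 hx).ne'
  unfold straight
  fun_prop (disch := exact hne)

theorem IsCkAt.comp_straight {n : ℕ} (hx : x.1 < 1) (hf : IsCkAt n f (straight x)) :
    IsCkAt n (fun y => f (straight y)) x := by
  obtain ⟨F, hF, hfF⟩ := hf
  refine ⟨fun e => F (e.1, 2 * e.2.1 * (1 - e.1)⁻¹, e.2.2), ?_,
    (continuousAt_straight hx).eventually hfF⟩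
  refine ContDiffAt.comp (ambient x) (g := F)
    (f := fun e : Amb => (e.1, 2 * e.2.1 * (1 - e.1)⁻¹, e.2.2)) hF ?_
  have hinv : ContDiffAt ℝ n (fun e : Amb => (1 - e.1)⁻¹) (ambient x) :=
    ContDiffAt.comp (ambient x) (g := fun t : ℝ => (1 - t)⁻¹) (f := fun e : Amb => e.1)
      (contDiffAt_inv_one_sub hx) contDiffAt_fst
  fun_prop

theorem IsCkAt.hasDerivAt_comp {γ : ℝ → Pt} {t a b : ℝ} (hf : IsCkAt 1 f (γ t))
    (hγ : ContinuousAt γ t) (hd : HasDerivAt (fun s => ambient (γ s)) (a, b, 0) t) :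
    HasDerivAt (fun s => f (γ s)) (a * dTau f (γ t) + b * dRho f (γ t)) t := by
  obtain ⟨F, hF, hfF⟩ := hf
  have hF' := hF.differentiableAt (by simp)
  have hframe (d : Dir) := (hasDerivAt_comp_curve hF' hfF d).deriv
  have hτ : dTau f (γ t) = fderiv ℝ F (ambient (γ t)) (1, 0, 0) :=
    (hframe .tau).trans (by simp only [Dir.linPart, Dir.constPart, _root_.zero_apply, add_zero])
  have hρ : dRho f (γ t) = fderiv ℝ F (ambient (γ t)) (0, 1, 0) :=
    (hframe .rho).trans (by simp only [Dir.linPart, Dir.constPart, _root_.zero_apply, add_zero])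
  have hab : ((a, b, 0) : Amb) = a • (1, 0, 0) + b • (0, 1, 0) := by simp
  rw [hab] at hd
  have h := HasFDerivAt.comp_hasDerivAt_of_eq t hF'.hasFDerivAt hd rfl
  rw [map_add, map_smul, map_smul, ← hτ, ← hρ, Complex.real_smul, Complex.real_smul] at h
  exact h.congr_of_eventuallyEq (hγ.eventually hfF)

theorem dTau_comp_straight (hx : x.1 < 1) (hf : IsCkAt 1 f (straight x)) :
    dTau (fun y => f (straight y)) x =
      dTau f (straight x) + 2 * x.2.1 * (1 - (x.1 : ℂ))⁻¹ ^ 2 * dRho f (straight x) := by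
  have hne : 1 - x.1 ≠ 0 := (sub_pos.2 hx).ne'
  have hinv : HasDerivAt (fun t : ℝ => (1 - t)⁻¹) (-(-1) / (1 - x.1) ^ 2) x.1 :=
    ((hasDerivAt_id x.1).const_sub 1).fun_inv hne
  have hd : HasDerivAt (fun t : ℝ => ambient (straight (t, x.2)))
      (1, 2 * x.2.1 * (1 - x.1)⁻¹ ^ 2, 0) x.1 :=
    ((hasDerivAt_id x.1).prodMk ((hinv.const_mul (2 * x.2.1)).prodMk
      (hasDerivAt_const x.1 (fun i j => x.2.2.1 i j : Fin 2 → Fin 2 → ℂ)))).congr_deriv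
      (by simp [div_eq_mul_inv])
  have hγ : ContinuousAt (fun t => straight (t, x.2)) x.1 :=
    ContinuousAt.comp (f := fun t => (t, x.2)) (continuousAt_straight hx) (by fun_prop)
  refine (IsCkAt.hasDerivAt_comp hf hγ hd).deriv.trans ?_
  push_cast
  rw [one_mul]

theorem dRho_comp_straight (hx : x.1 < 1) (hf : IsCkAt 1 f (straight x)) :
    dRho (fun y => f (straight y)) x = 2 * (1 - (x.1 : ℂ))⁻¹ * dRho f (straight x) := by
  have hd : HasDerivAt (fun t : ℝ => ambient (straight (x.1, t, x.2.2)))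
      (0, 2 * (1 - x.1)⁻¹, 0) x.2.1 :=
    ((hasDerivAt_const x.2.1 x.1).prodMk
      ((((hasDerivAt_id x.2.1).const_mul 2).mul_const (1 - x.1)⁻¹).prodMk
      (hasDerivAt_const x.2.1 (fun i j => x.2.2.1 i j : Fin 2 → Fin 2 → ℂ)))).congr_deriv
      (by rw [mul_one])
  have hγ : ContinuousAt (fun t => straight (x.1, t, x.2.2)) x.2.1 :=
    ContinuousAt.comp (f := fun t => (x.1, t, x.2.2)) (continuousAt_straight hx) (by fun_prop)
  refine (IsCkAt.hasDerivAt_comp hf hγ hd).deriv.trans ?_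
  push_cast
  rw [zero_mul, zero_add]

/-- The counterpart of `boxSource` before straightening: the rate at which `(u, w)` fails to solve
`nullDer (-1) w = X₊ u`, `nullDer 1 u = X₋ w`, paired with `(u, w)`. -/
def nullSource (u w : Pt → ℂ) (x : Pt) : ℝ :=
  inner ℝ (w x) (nullDer (-1) w x - XPlus u x) + inner ℝ (u x) (nullDer 1 u x - XMinus w x)

theorem boxSource_comp_straight {u w : Pt → ℂ} (hx : x.1 < 1) (hu : IsCkAt 1 u (straight x))
    (hw : IsCkAt 1 w (straight x)) :
    boxSource (fun y => u (straight y)) (fun y => w (straight y)) x =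
      nullSource u w (straight x) := by
  have hne : 1 - (x.1 : ℂ) ≠ 0 := mod_cast (sub_pos.2 hx).ne'
  have hout : (1 - (x.1 : ℂ)) * dTau (fun y => w (straight y)) x =
      nullDer (-1) w (straight x) := by
    rw [dTau_comp_straight hx hw]
    simp only [nullDer, straight]
    push_cast
    field_simp
    ring
  have hin : (1 + (x.1 : ℂ)) * dTau (fun y => u (straight y)) x -
      2 * x.2.1 * (1 - (x.1 : ℂ))⁻¹ * dRho (fun y => u (straight y)) x =
      nullDer 1 u (straight x) := by
    rw [dTau_comp_straight hx hu, dRho_comp_straight hx hu]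
    simp only [nullDer, straight]
    push_cast
    field_simp
    ring
  rw [boxSource, hout, hin]
  rfl

end Straight

/-- The part `2c ≤ ρ (1 - τ) ≤ 2d`, `-1 ≤ τ ≤ T` of `ℝ × ℝ × SU(2)`. -/
def wedge (T c d : ℝ) : Set Pt :=
  {x | -1 ≤ x.1 ∧ x.1 ≤ T ∧ 2 * c * (1 - x.1)⁻¹ ≤ x.2.1 ∧ x.2.1 ≤ 2 * d * (1 - x.1)⁻¹}

section Wedge

variable {T c d : ℝ}

theorem measurableSet_box (a b c d : ℝ) : MeasurableSet (box a b c d) :=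
  measurableSet_Icc.prod (measurableSet_Icc.prod MeasurableSet.univ)

theorem measurableSet_wedge (T c d : ℝ) : MeasurableSet (wedge T c d) := by
  have hinv : Measurable fun x : Pt => (1 - x.1)⁻¹ := by fun_prop
  have hτ : Measurable fun x : Pt => x.1 := by fun_prop
  have hρ : Measurable fun x : Pt => x.2.1 := by fun_prop
  exact (measurableSet_le measurable_const hτ).inter
    ((measurableSet_le hτ measurable_const).inter
      ((measurableSet_le (hinv.const_mul _) hρ).inter (measurableSet_le hρ (hinv.const_mul _))))

theorem straight_mem_wedge {x : Pt} (hT : T ≤ 0) :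
    straight x ∈ wedge T c d ↔ x ∈ box (-1) T c d := by
  rw [mem_box]
  simp only [straight, wedge, Set.mem_ofPred_eq, Set.mem_Icc, ← and_assoc (a := -1 ≤ x.1)]
  refine and_congr_right fun hx => ?_
  have hinv : 0 < (1 - x.1)⁻¹ := inv_pos.2 (by linarith [hx.2])
  rw [mul_le_mul_iff_left₀ hinv, mul_le_mul_iff_left₀ hinv, mul_le_mul_iff_right₀ two_pos,
    mul_le_mul_iff_right₀ two_pos]

theorem lintegral_slabMeasure_mul_left {a : ℝ} (ha : 0 < a) (φ : ℝ × SU2 → ℝ≥0∞) :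
    ∫⁻ y, φ y ∂slabMeasure = ∫⁻ y, ENNReal.ofReal a * φ (a * y.1, y.2) ∂slabMeasure := by
  let S : ℝ × SU2 ≃ᵐ ℝ × SU2 :=
    (Homeomorph.mulLeft₀ a ha.ne').toMeasurableEquiv.prodCongr (MeasurableEquiv.refl SU2)
  have hmap : slabMeasure.map S = ENNReal.ofReal |a⁻¹| • slabMeasure := by
    have h := Measure.map_prod_map (volume : Measure ℝ) haarSU2
      (f := fun t => a * t) (g := id) (measurable_const_mul a) measurable_id
    rw [Real.map_volume_mul_left ha.ne', Measure.map_id, Measure.prod_smul_left] at h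
    exact h.symm
  have h := lintegral_map_equiv (μ := slabMeasure) φ S
  rw [hmap, lintegral_smul_measure] at h
  rw [lintegral_const_mul' _ _ ENNReal.ofReal_ne_top]
  change _ = _ * ∫⁻ y, φ (S y) ∂slabMeasure
  rw [← h, smul_eq_mul, ← mul_assoc, ← ENNReal.ofReal_mul ha.le, abs_of_pos (inv_pos.2 ha),
    mul_inv_cancel₀ ha.ne', ENNReal.ofReal_one, one_mul]

theorem lintegral_wedge (hT : T ≤ 0) {φ : Pt → ℝ≥0∞}
    (hφ : ∀ x ∈ wedge T c d, ContinuousAt φ x) :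
    ∫⁻ x in wedge T c d, φ x ∂dv =
      ∫⁻ x in box (-1) T c d, ENNReal.ofReal (2 * (1 - x.1)⁻¹) * φ (straight x) ∂dv := by
  have hbox := measurableSet_box (-1) T c d
  have hwedge := measurableSet_wedge T c d
  have hφm : AEMeasurable φ (dv.restrict (wedge T c d)) :=
    ContinuousOn.aemeasurable (fun x hx => (hφ x hx).continuousWithinAt) hwedge
  have hsm : AEMeasurable (fun x => φ (straight x)) (dv.restrict (box (-1) T c d)) :=
    ContinuousOn.aemeasurable (fun x hx => (ContinuousAt.comp (g := φ)
      (hφ _ ((straight_mem_wedge hT).2 hx)) (continuousAt_straight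
        (by linarith [(mem_box.1 hx).1.2]))).continuousWithinAt) hbox
  have hjm : Measurable fun x : Pt => ENNReal.ofReal (2 * (1 - x.1)⁻¹) := by fun_prop
  have hjsm : AEMeasurable (fun x => ENNReal.ofReal (2 * (1 - x.1)⁻¹) * φ (straight x))
      (dv.restrict (box (-1) T c d)) := hjm.aemeasurable.mul hsm
  rw [← lintegral_indicator hwedge, ← lintegral_indicator hbox]
  unfold dv at *
  rw [lintegral_prod _ ((aemeasurable_indicator_iff hwedge).2 hφm),
    lintegral_prod _ ((aemeasurable_indicator_iff hbox).2 hjsm)]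
  refine lintegral_congr fun τ => ?_
  by_cases hτ : τ ∈ Set.Icc (-1) T
  · have hscale : 0 < 2 * (1 - τ)⁻¹ := mul_pos two_pos (inv_pos.2 (by linarith [hτ.2]))
    rw [lintegral_slabMeasure_mul_left hscale]
    refine lintegral_congr fun y => ?_
    have hs : (τ, 2 * (1 - τ)⁻¹ * y.1, y.2) = straight (τ, y) := by
      simp only [straight, mul_right_comm]
    rw [hs]
    by_cases hy : (τ, y) ∈ box (-1) T c d
    · rw [Set.indicator_of_mem hy, Set.indicator_of_mem ((straight_mem_wedge hT).2 hy)]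
    · rw [Set.indicator_of_notMem hy,
        Set.indicator_of_notMem fun h => hy ((straight_mem_wedge hT).1 h), mul_zero]
  · refine lintegral_congr fun y => ?_
    rw [Set.indicator_of_notMem fun h => hτ ⟨h.1, h.2.1⟩,
      Set.indicator_of_notMem fun h => hτ (mem_box.1 h).1]

theorem lintegral_wedge_ofReal (hT : T ≤ 0) {φ : Pt → ℝ} (hφ₀ : ∀ x, 0 ≤ φ x)
    (hφ : ∀ x ∈ wedge T c d, ContinuousAt φ x) :
    ∫⁻ x in wedge T c d, ENNReal.ofReal (φ x) ∂dv =
      ENNReal.ofReal (∫ x in box (-1) T c d, 2 * (1 - x.1)⁻¹ * φ (straight x) ∂dv) := by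
  have hlt {x : Pt} (hx : x ∈ box (-1) T c d) : x.1 < 1 := by linarith [(mem_box.1 hx).1.2]
  have hinv {x : Pt} (hx : x ∈ box (-1) T c d) : 0 ≤ 2 * (1 - x.1)⁻¹ :=
    mul_nonneg zero_le_two (inv_nonneg.2 (sub_nonneg.2 (hlt hx).le))
  rw [lintegral_wedge (φ := fun x => ENNReal.ofReal (φ x)) hT fun x hx =>
      ENNReal.continuous_ofReal.continuousAt.comp (hφ x hx),
    ofReal_integral_eq_lintegral_ofReal]
  · exact setLIntegral_congr_fun (measurableSet_box _ _ _ _) fun x hx =>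
      (ENNReal.ofReal_mul (hinv hx)).symm
  · refine integrableOn_box fun x hx => ?_
    have hne : 1 - x.1 ≠ 0 := (sub_pos.2 (hlt hx)).ne'
    exact (continuousAt_const.mul ((continuousAt_const.sub continuousAt_fst).inv₀ hne)).mul
      (ContinuousAt.comp (hφ _ ((straight_mem_wedge hT).2 hx)) (continuousAt_straight (hlt hx)))
  · filter_upwards [ae_restrict_mem (measurableSet_box _ _ _ _)] with x hx
    exact mul_nonneg (hinv hx) (hφ₀ _)

end Wedge

/-! ### The characteristic data and the energy estimate up to the cylinder -/

/-- The part of the lower domain off the cylinder `ρ = 0`, where the fields are regular. -/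
def regularDomain (ρs ε : ℝ) : Set Pt := {x ∈ lowerDomain ρs ε | 0 < x.2.1}

/-- The measure `dρ dμ` on the portion `0 ≤ ρ ≤ ρ⋆` of past null infinity `τ = -1`. -/
def scriMeasure (ρs : ℝ) : Measure Pt := (slabMeasure.restrict (slab 0 ρs)).map (Prod.mk (-1))

/-- The parametrisation of the incoming null hypersurface `ρ = 2ρ⋆/(1-τ)` by `(τ, g)`. -/
def nullMap (ρs : ℝ) (y : ℝ × SU2) : Pt := (y.1, 2 * ρs / (1 - y.1), y.2)

/-- The measure induced by `dv` on the portion `-1 ≤ τ ≤ -1+ε` of the incoming null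
hypersurface. -/
def nullMeasure (ρs ε : ℝ) : Measure Pt :=
  ((slabMeasure.restrict (slab (-1) (-1 + ε))).withDensity
    fun y => ENNReal.ofReal (nullDensity ρs y.1)).map (nullMap ρs)

section Measures

variable {ρs ε : ℝ}

theorem lintegral_scriMeasure (φ : Pt → ℝ≥0∞) :
    ∫⁻ x, φ x ∂scriMeasure ρs = ∫⁻ y in slab 0 ρs, φ (-1, y) ∂slabMeasure :=
  (measurableEmbedding_prodMk_left _).lintegral_map _

theorem measurableEmbedding_nullMap (ρs : ℝ) : MeasurableEmbedding (nullMap ρs) := by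
  have hrange : Set.range (nullMap ρs) = {x | x.2.1 = 2 * ρs / (1 - x.1)} := by
    ext ⟨τ, ρ, g⟩
    constructor
    · rintro ⟨y, hy⟩
      simp only [nullMap, Prod.mk.injEq] at hy
      simp only [Set.mem_ofPred_eq, ← hy.1, ← hy.2.1]
    · exact fun hρ => ⟨(τ, g), Prod.ext rfl (Prod.ext hρ.symm rfl)⟩
  refine MeasurableEmbedding.of_measurable_inverse (g := fun x : Pt => (x.1, x.2.2))
    (by unfold nullMap; fun_prop) ?_ (by fun_prop) fun y => rfl
  rw [hrange]
  exact measurableSet_eq_fun (by fun_prop) (by fun_prop)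

theorem measurable_nullDensity (ρs : ℝ) : Measurable (nullDensity ρs) := by
  unfold nullDensity
  fun_prop

theorem lintegral_nullMeasure (φ : Pt → ℝ≥0∞) :
    ∫⁻ x, φ x ∂nullMeasure ρs ε = ∫⁻ y in slab (-1) (-1 + ε),
      φ (nullMap ρs y) * ENNReal.ofReal (nullDensity ρs y.1) ∂slabMeasure := by
  have hmeas : Measurable fun y : ℝ × SU2 => ENNReal.ofReal (nullDensity ρs y.1) :=
    ((measurable_nullDensity ρs).comp measurable_fst).ennreal_ofReal
  refine ((measurableEmbedding_nullMap ρs).lintegral_map _).trans ?_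
  rw [lintegral_withDensity_eq_lintegral_mul_non_measurable _ hmeas
    (.of_forall fun _ => ENNReal.ofReal_lt_top)]
  exact lintegral_congr fun y => mul_comm _ _

theorem two_mul_inv_sq_le_nullDensity (hρ : 0 ≤ ρs) {τ : ℝ} (hτ : τ < 1) :
    2 * ρs * (1 - τ)⁻¹ ^ 2 ≤ nullDensity ρs τ := by
  have hne : 1 - τ ≠ 0 := (sub_pos.2 hτ).ne'
  have hsqrt : Real.sqrt 2 ≤ 2 := Real.sqrt_le_iff.2 ⟨zero_le_two, by norm_num⟩
  have hdensity : nullDensity ρs τ = 2 * ρs * (1 - τ)⁻¹ ^ 2 * (2 / Real.sqrt 2) := by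
    unfold nullDensity
    field_simp
    ring
  rw [hdensity]
  exact le_mul_of_one_le_right (by positivity) ((one_le_div (by positivity)).2 hsqrt)

theorem ofReal_norm_sq (z : ℂ) : ENNReal.ofReal (‖z‖ ^ 2) = ‖z‖ₑ ^ 2 := by
  rw [ENNReal.ofReal_pow (norm_nonneg _), ofReal_norm]

theorem ofReal_boxInflow_le (hε : ε ≤ 1) {c : ℝ} (hc : 0 ≤ c) (hρ : 0 ≤ ρs) (u w : Pt → ℂ) :
    ENNReal.ofReal (boxInflow (-1 + ε) c ρs (fun x => u (straight x)) fun x => w (straight x)) ≤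
      ∫⁻ x, ‖w x‖ₑ ^ 2 ∂scriMeasure ρs + ∫⁻ x, ‖u x‖ₑ ^ 2 ∂nullMeasure ρs ε := by
  have hofReal (S : Set (ℝ × SU2)) (h : ℝ × SU2 → ℝ) (h₀ : ∀ y, 0 ≤ h y) :
      ENNReal.ofReal (∫ y in S, h y ∂slabMeasure) ≤
        ∫⁻ y in S, ENNReal.ofReal (h y) ∂slabMeasure := by
    refine (Real.ofReal_le_enorm _).trans ((enorm_integral_le_lintegral_enorm _).trans_eq ?_)
    exact lintegral_congr fun y => Real.enorm_of_nonneg (h₀ y)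
  have hscri (y : ℝ × SU2) : straight (-1, y.1, y.2) = (-1, y) := by
    simp only [straight, sub_neg_eq_add, one_add_one_eq_two]
    rw [mul_comm 2, mul_inv_cancel_right₀ two_ne_zero]
  have hnull (y : ℝ × SU2) : straight (y.1, ρs, y.2) = nullMap ρs y := by
    simp only [straight, nullMap, div_eq_mul_inv]
  rw [lintegral_scriMeasure, lintegral_nullMeasure]
  refine ENNReal.ofReal_add_le.trans (add_le_add ?_ ?_)
  · refine (hofReal _ _ fun y => by positivity).trans ?_
    refine (lintegral_mono_set (Set.prod_mono_left (Set.Icc_subset_Icc_left hc))).trans_eq ?_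
    exact lintegral_congr fun y => by simp only [hscri, ofReal_norm_sq]
  · refine (hofReal _ _ fun y => by positivity).trans
      (setLIntegral_mono' (measurableSet_Icc.prod MeasurableSet.univ) fun y hy => ?_)
    have hy₁ : y.1 < 1 := by linarith [hy.1.2]
    simp only [hnull]
    rw [ENNReal.ofReal_mul (by positivity), ofReal_norm_sq, mul_comm]
    gcongr
    exact two_mul_inv_sq_le_nullDensity hρ hy₁

end Measures

section EnergyEstimate

variable {ι : Type*} (I : Finset ι) {K ρs ε c : ℝ} {u w : ι → Pt → ℂ}

theorem straight_mem_interior_wedge {T d : ℝ} {x : Pt} (hx : x.1 < 1)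
    (hτ : x.1 ∈ Set.Ioo (-1) T) (hρ : x.2.1 ∈ Set.Ioo c d) :
    straight x ∈ interior (wedge T c d) := by
  have hinv : 0 < (1 - x.1)⁻¹ := inv_pos.2 (sub_pos.2 hx)
  have hne : 1 - (straight x).1 ≠ 0 := (sub_pos.2 hx).ne'
  have hbound (r : ℝ) : ContinuousAt (fun y : Pt => 2 * r * (1 - y.1)⁻¹) (straight x) := by
    fun_prop (disch := exact hne)
  have hτc : ContinuousAt (fun y : Pt => y.1) (straight x) := by fun_prop
  have hρc : ContinuousAt (fun y : Pt => y.2.1) (straight x) := by fun_prop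
  rw [mem_interior_iff_mem_nhds]
  filter_upwards [continuousAt_const.eventually_lt hτc hτ.1, hτc.eventually_lt_const hτ.2,
    (hbound c).eventually_lt hρc (mul_lt_mul_of_pos_right (by linarith [hρ.1]) hinv),
    hρc.eventually_lt (hbound d) (mul_lt_mul_of_pos_right (by linarith [hρ.2]) hinv)]
    with y h₁ h₂ h₃ h₄
  exact ⟨h₁.le, h₂.le, h₃.le, h₄.le⟩

theorem lintegral_wedge_energy_le (hK : 0 ≤ K) (hε₀ : 0 ≤ ε) (hε₁ : ε ≤ 1) (hc : 0 ≤ c)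
    (hcρ : c ≤ ρs) (hu : ∀ i ∈ I, ∀ x ∈ wedge (-1 + ε) c ρs, IsCkAt 1 (u i) x)
    (hw : ∀ i ∈ I, ∀ x ∈ wedge (-1 + ε) c ρs, IsCkAt 1 (w i) x)
    (hsource : ∀ x ∈ interior (wedge (-1 + ε) c ρs), 2 * ∑ i ∈ I, nullSource (u i) (w i) x ≤
      (K - 1) * ∑ i ∈ I, ‖w i x‖ ^ 2 - ∑ i ∈ I, ‖u i x‖ ^ 2) :
    ∫⁻ x in wedge (-1 + ε) c ρs, ∑ i ∈ I, (‖u i x‖ₑ ^ 2 + ‖w i x‖ₑ ^ 2) ∂dv ≤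
      ENNReal.ofReal (2 * Real.exp K) * ∑ i ∈ I,
        (∫⁻ x, ‖w i x‖ₑ ^ 2 ∂scriMeasure ρs + ∫⁻ x, ‖u i x‖ₑ ^ 2 ∂nullMeasure ρs ε) := by
  have hT : -1 + ε ≤ 0 := by linarith
  have hstraight {f : Pt → ℂ} (hf : ∀ x ∈ wedge (-1 + ε) c ρs, IsCkAt 1 f x) (x : Pt)
      (hx : x ∈ box (-1) (-1 + ε) c ρs) : IsCkAt 1 (fun y => f (straight y)) x :=
    IsCkAt.comp_straight (by linarith [(mem_box.1 hx).1.2]) (hf _ ((straight_mem_wedge hT).2 hx))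
  have hcont (x : Pt) (hx : x ∈ wedge (-1 + ε) c ρs) :
      ContinuousAt (fun y => ∑ i ∈ I, (‖u i y‖ ^ 2 + ‖w i y‖ ^ 2)) x :=
    tendsto_finsetSum _ fun i hi =>
      ((hu i hi x hx).continuousAt.norm.tendsto.pow 2).add
        ((hw i hi x hx).continuousAt.norm.tendsto.pow 2)
  have hbox := integral_box_le_boxInflow I hK (by linarith) hT hc hcρ
    (fun i hi => hstraight (hu i hi)) (fun i hi => hstraight (hw i hi)) fun x hτ hρ => by
      have hx : x.1 < 1 := by linarith [hτ.2]
      have hint := straight_mem_interior_wedge hx hτ hρ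
      have hmem := interior_subset hint
      rw [Finset.sum_congr rfl fun i hi =>
        boxSource_comp_straight hx (hu i hi _ hmem) (hw i hi _ hmem)]
      exact hsource _ hint
  calc ∫⁻ x in wedge (-1 + ε) c ρs, ∑ i ∈ I, (‖u i x‖ₑ ^ 2 + ‖w i x‖ₑ ^ 2) ∂dv
      = ∫⁻ x in wedge (-1 + ε) c ρs,
          ENNReal.ofReal (∑ i ∈ I, (‖u i x‖ ^ 2 + ‖w i x‖ ^ 2)) ∂dv := by
        refine lintegral_congr fun x => ?_
        rw [ENNReal.ofReal_sum_of_nonneg fun i _ => by positivity]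
        refine Finset.sum_congr rfl fun i _ => ?_
        rw [ENNReal.ofReal_add (by positivity) (by positivity), ofReal_norm_sq, ofReal_norm_sq]
    _ = ENNReal.ofReal (2 * ∫ x in box (-1) (-1 + ε) c ρs, (1 - x.1)⁻¹ *
          ∑ i ∈ I, (‖u i (straight x)‖ ^ 2 + ‖w i (straight x)‖ ^ 2) ∂dv) := by
        rw [lintegral_wedge_ofReal hT (fun x => by positivity) hcont, ← integral_const_mul]
        simp only [mul_assoc]
    _ ≤ ENNReal.ofReal (2 * (Real.exp K * ∑ i ∈ I, boxInflow (-1 + ε) c ρs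
          (fun x => u i (straight x)) fun x => w i (straight x))) := by gcongr
    _ ≤ _ := by
        rw [← mul_assoc, ENNReal.ofReal_mul (by positivity)]
        gcongr
        refine (Finset.le_sum_of_subadditive _ ENNReal.ofReal_zero.le
          (fun _ _ => ENNReal.ofReal_add_le) I _).trans (Finset.sum_le_sum fun i _ => ?_)
        exact ofReal_boxInflow_le hε₁ hc (hc.trans hcρ) (u i) (w i)

theorem ae_rho_ne_zero : ∀ᵐ x ∂dv, x.2.1 ≠ 0 := by
  have h : {x : Pt | ¬ x.2.1 ≠ 0} = Set.univ ×ˢ ({0} : Set ℝ) ×ˢ Set.univ := by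
    ext x
    simp
  rw [ae_iff, h, dv, Measure.prod_prod, Measure.prod_prod, Real.volume_singleton, zero_mul,
    mul_zero]

theorem wedge_subset_regularDomain (hε : ε < 2) (hc : 0 < c) :
    wedge (-1 + ε) c ρs ⊆ regularDomain ρs ε := by
  rintro x ⟨h₁, h₂, h₃, h₄⟩
  have hinv : 0 < (1 - x.1)⁻¹ := inv_pos.2 (by linarith [hε])
  have hρ : 0 < x.2.1 := lt_of_lt_of_le (by positivity) h₃
  exact ⟨⟨h₁, h₂, hρ.le, h₄⟩, hρ⟩

theorem exists_mem_wedge {x : Pt} (hx : x ∈ regularDomain ρs ε) :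
    ∃ n : ℕ, x ∈ wedge (-1 + ε) (ρs / (n + 1)) ρs := by
  obtain ⟨⟨h₁, h₂, -, h₄⟩, hρ⟩ := hx
  have hlim : Filter.Tendsto (fun n : ℕ => 2 * (ρs * (1 / (n + 1))) * (1 - x.1)⁻¹) Filter.atTop
      (𝓝 (2 * (ρs * 0) * (1 - x.1)⁻¹)) :=
    ((tendsto_one_div_add_atTop_nhds_zero_nat.const_mul ρs).const_mul 2).mul_const _
  rw [mul_zero, mul_zero, zero_mul] at hlim
  obtain ⟨n, hn⟩ := (hlim.eventually_lt_const hρ).exists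
  exact ⟨n, h₁, h₂, by rw [← mul_one_div]; exact hn.le, h₄⟩

theorem lintegral_lowerDomain_energy_le (hK : 0 ≤ K) (hρ : 0 < ρs) (hε₀ : 0 ≤ ε) (hε₁ : ε ≤ 1)
    (hu : ∀ i ∈ I, ∀ x ∈ regularDomain ρs ε, IsCkAt 1 (u i) x)
    (hw : ∀ i ∈ I, ∀ x ∈ regularDomain ρs ε, IsCkAt 1 (w i) x)
    (hsource : ∀ x ∈ interior (regularDomain ρs ε), 2 * ∑ i ∈ I, nullSource (u i) (w i) x ≤
      (K - 1) * ∑ i ∈ I, ‖w i x‖ ^ 2 - ∑ i ∈ I, ‖u i x‖ ^ 2) :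
    ∫⁻ x in lowerDomain ρs ε, ∑ i ∈ I, (‖u i x‖ₑ ^ 2 + ‖w i x‖ₑ ^ 2) ∂dv ≤
      ENNReal.ofReal (2 * Real.exp K) * ∑ i ∈ I,
        (∫⁻ x, ‖w i x‖ₑ ^ 2 ∂scriMeasure ρs + ∫⁻ x, ‖u i x‖ₑ ^ 2 ∂nullMeasure ρs ε) := by
  have hε₂ : ε < 2 := hε₁.trans_lt one_lt_two
  have hmono : Monotone fun n : ℕ => wedge (-1 + ε) (ρs / (n + 1)) ρs := by
    rintro n m hnm x ⟨h₁, h₂, h₃, h₄⟩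
    have hinv : 0 < (1 - x.1)⁻¹ := inv_pos.2 (by linarith)
    refine ⟨h₁, h₂, le_trans ?_ h₃, h₄⟩
    gcongr
  have hcover : (lowerDomain ρs ε : Set Pt) ≤ᵐ[dv]
      ⋃ n : ℕ, wedge (-1 + ε) (ρs / (n + 1)) ρs := by
    filter_upwards [ae_rho_ne_zero] with x hx₀ hx
    exact Set.mem_iUnion.2 (exists_mem_wedge ⟨hx, hx.2.2.1.lt_of_ne' hx₀⟩)
  refine (lintegral_mono' (Measure.restrict_mono_ae hcover) le_rfl).trans ?_
  rw [setLIntegral_iUnion_of_directed _ hmono.directed_le]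
  refine iSup_le fun n => ?_
  have hsub : wedge (-1 + ε) (ρs / (n + 1)) ρs ⊆ regularDomain ρs ε :=
    wedge_subset_regularDomain hε₂ (by positivity)
  exact lintegral_wedge_energy_le I hK hε₀ hε₁ (by positivity) (div_le_self hρ.le (by simp))
    (fun i hi x hx => hu i hi x (hsub hx)) (fun i hi x hx => hw i hi x (hsub hx))
    fun x hx => hsource x (interior_mono hsub hx)

end EnergyEstimate

/-! ### The squared Sobolev norms -/

theorem mem_multiIndices {m : ℕ} {i : ℕ × ℕ × (ℕ × ℕ × ℕ)} :
    i ∈ multiIndices m ↔ i.1 + i.2.1 + deg i.2.2 ≤ m := by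
  obtain ⟨a, b, c, d, e⟩ := i
  unfold multiIndices
  rw [Finset.mem_filter]
  simp only [Finset.mem_product, Finset.mem_range, deg]
  omega

/-- The derivative `∂_ρ^{p'+p} ∂_τ^{q'+q} Z^α` for the index `i = (p', q', α)`. -/
def shiftedD (p q : ℕ) (i : ℕ × ℕ × (ℕ × ℕ × ℕ)) (f : Pt → ℂ) : Pt → ℂ :=
  D (i.1 + p) (i.2.1 + q) i.2.2 f

/-- The squared norm `∑_{p'+q'+|α| ≤ m} ∫ |∂_ρ^{p'+p} ∂_τ^{q'+q} Z^α f|² dν`, which unifies the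
norms over the lower domain and over the characteristic hypersurfaces. -/
def shiftedSobolevSq (m p q : ℕ) (ν : Measure Pt) (f : Pt → ℂ) : ℝ≥0∞ :=
  ∑ i ∈ multiIndices m, ∫⁻ x, ‖shiftedD p q i f x‖ₑ ^ 2 ∂ν

/-- The measure on the union of past null infinity and the incoming null hypersurface with respect
to which the characteristic data are integrated. -/
def charMeasure (ρs ε : ℝ) : Measure Pt := scriMeasure ρs + nullMeasure ρs ε

section Norms

variable {m n p q : ℕ} {i : ℕ × ℕ × (ℕ × ℕ × ℕ)} {f g : Pt → ℂ} {x : Pt}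

theorem IsCkAt.shiftedD (hi : i ∈ multiIndices m) (hf : IsCkAt (m + p + q + n) f x) :
    IsCkAt n (shiftedD p q i f) x := by
  have hdeg := mem_multiIndices.1 hi
  exact IsCkAt.D (hf.of_le (by omega))

theorem shiftedD_mul_add_mul (hi : i ∈ multiIndices m) (hf : IsCkAt (m + p + q) f x)
    (hg : IsCkAt (m + p + q) g x) (s t : ℂ) :
    shiftedD p q i (fun y => s * f y + t * g y) x =
      s * shiftedD p q i f x + t * shiftedD p q i g x := by
  have hdeg := mem_multiIndices.1 hi
  exact (D_mul_add_mul (hf.of_le (by omega)) (hg.of_le (by omega)) s t).self_of_nhds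

theorem sobolevSq_eq_shiftedSobolevSq (m : ℕ) (S : Set Pt) (f : Pt → ℂ) :
    sobolevSq m S f = shiftedSobolevSq m 0 0 (dv.restrict S) f := rfl

theorem scriDataSq_add_nullDataSq (m : ℕ) (ρs ε : ℝ) (f : Pt → ℂ) :
    scriDataSq m ρs f + nullDataSq m ρs ε f = shiftedSobolevSq m 0 0 (charMeasure ρs ε) f := by
  simp only [shiftedSobolevSq, charMeasure, lintegral_add_measure, lintegral_scriMeasure,
    lintegral_nullMeasure, Finset.sum_add_distrib]
  rfl

theorem enorm_mul_add_mul_sq_le {s t : ℂ} (hs : ‖s‖ ≤ 1) (ht : ‖t‖ ≤ 1) (z v : ℂ) :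
    ‖s * z + t * v‖ₑ ^ 2 ≤ 2 * ‖z‖ₑ ^ 2 + 2 * ‖v‖ₑ ^ 2 := by
  have hnorm : ‖s * z + t * v‖ ≤ ‖z‖ + ‖v‖ := by
    refine (norm_add_le _ _).trans ?_
    rw [norm_mul, norm_mul]
    exact add_le_add (mul_le_of_le_one_left (norm_nonneg _) hs)
      (mul_le_of_le_one_left (norm_nonneg _) ht)
  have hsq : ‖s * z + t * v‖ ^ 2 ≤ 2 * ‖z‖ ^ 2 + 2 * ‖v‖ ^ 2 := by
    refine (pow_le_pow_left₀ (norm_nonneg _) hnorm 2).trans ?_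
    linarith [add_sq_le (a := ‖z‖) (b := ‖v‖)]
  have hofReal := ENNReal.ofReal_le_ofReal hsq
  rwa [ENNReal.ofReal_add (by positivity) (by positivity), ENNReal.ofReal_mul zero_le_two,
    ENNReal.ofReal_mul zero_le_two, ofReal_norm_sq, ofReal_norm_sq, ofReal_norm_sq,
    ENNReal.ofReal_ofNat] at hofReal

variable {ν : Measure Pt} {S : Set Pt}

theorem aemeasurable_enorm_shiftedD_sq (hS : MeasurableSet S) (hν : ∀ᵐ x ∂ν, x ∈ S)
    (hi : i ∈ multiIndices m) (hf : ∀ x ∈ S, IsCkAt (m + p + q) f x) :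
    AEMeasurable (fun x => ‖shiftedD p q i f x‖ₑ ^ 2) ν := by
  rw [← Measure.restrict_eq_self_of_ae_mem hν]
  have hcont : ContinuousOn (shiftedD p q i f) S := fun x hx =>
    (IsCkAt.shiftedD (n := 0) hi (hf x hx)).continuousAt.continuousWithinAt
  exact (hcont.enorm.aemeasurable hS).pow_const 2

theorem shiftedSobolevSq_mul_add_mul_le (hS : MeasurableSet S) (hν : ∀ᵐ x ∂ν, x ∈ S)
    (hf : ∀ x ∈ S, IsCkAt (m + p + q) f x) (hg : ∀ x ∈ S, IsCkAt (m + p + q) g x) {s t : ℂ}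
    (hs : ‖s‖ ≤ 1) (ht : ‖t‖ ≤ 1) :
    shiftedSobolevSq m p q ν (fun y => s * f y + t * g y) ≤
      2 * shiftedSobolevSq m p q ν f + 2 * shiftedSobolevSq m p q ν g := by
  simp only [shiftedSobolevSq, Finset.mul_sum, ← Finset.sum_add_distrib]
  refine Finset.sum_le_sum fun i hi => ?_
  rw [← lintegral_const_mul' _ _ ENNReal.ofNat_ne_top,
    ← lintegral_const_mul' _ _ ENNReal.ofNat_ne_top,
    ← lintegral_add_left' ((aemeasurable_enorm_shiftedD_sq hS hν hi hf).const_mul 2)]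
  refine lintegral_mono_ae ?_
  filter_upwards [hν] with x hx
  rw [shiftedD_mul_add_mul hi (hf x hx) (hg x hx)]
  exact enorm_mul_add_mul_sq_le hs ht _ _

theorem shiftedSobolevSq_dRho_dTau (hν : ∀ᵐ x ∂ν, x ∈ S)
    (hf : ∀ x ∈ S, IsCkAt (m + p + q) f x) :
    shiftedSobolevSq m 0 0 ν (dRho^[p] (dTau^[q] f)) = shiftedSobolevSq m p q ν f := by
  refine Finset.sum_congr rfl fun i hi => lintegral_congr_ae ?_
  have hdeg := mem_multiIndices.1 hi
  filter_upwards [hν] with x hx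
  rw [shiftedD, add_zero, add_zero,
    (D_dRho_dTau p q ((hf x hx).of_le (by omega))).self_of_nhds, shiftedD]

theorem shiftedSobolevSq_dTau_dRho (hν : ∀ᵐ x ∂ν, x ∈ S)
    (hf : ∀ x ∈ S, IsCkAt (m + p + q) f x) :
    shiftedSobolevSq m 0 0 ν (dTau^[q] (dRho^[p] f)) = shiftedSobolevSq m p q ν f := by
  refine Finset.sum_congr rfl fun i hi => lintegral_congr_ae ?_
  have hdeg := mem_multiIndices.1 hi
  filter_upwards [hν] with x hx
  rw [shiftedD, add_zero, add_zero,
    (D_dTau_dRho p q ((hf x hx).of_le (by omega))).self_of_nhds, shiftedD]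

end Norms

section Supports

variable {ρs ε : ℝ}

theorem measurableSet_lowerDomain (ρs ε : ℝ) : MeasurableSet (lowerDomain ρs ε) := by
  have hτ : Measurable fun x : Pt => x.1 := by fun_prop
  have hρ : Measurable fun x : Pt => x.2.1 := by fun_prop
  exact (measurableSet_le measurable_const hτ).inter ((measurableSet_le hτ measurable_const).inter
    ((measurableSet_le measurable_const hρ).inter (measurableSet_le hρ (by fun_prop))))

theorem measurableSet_regularDomain (ρs ε : ℝ) : MeasurableSet (regularDomain ρs ε) :=
  (measurableSet_lowerDomain ρs ε).inter
    (measurableSet_lt measurable_const (measurable_fst.comp measurable_snd))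

theorem ae_restrict_lowerDomain_mem_regularDomain (ρs ε : ℝ) :
    ∀ᵐ x ∂dv.restrict (lowerDomain ρs ε), x ∈ regularDomain ρs ε := by
  filter_upwards [ae_restrict_mem (measurableSet_lowerDomain ρs ε),
    ae_restrict_of_ae ae_rho_ne_zero] with x hx hx₀
  exact ⟨hx, hx.2.2.1.lt_of_ne' hx₀⟩

theorem ae_scriMeasure_mem_regularDomain (hε : 0 ≤ ε) :
    ∀ᵐ x ∂scriMeasure ρs, x ∈ regularDomain ρs ε := by
  have hIoc : (Set.Ioc 0 ρs ×ˢ Set.univ : Set (ℝ × SU2)) =ᵐ[slabMeasure] slab 0 ρs :=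
    Measure.set_prod_ae_eq Ioc_ae_eq_Icc Filter.EventuallyEq.rfl
  rw [scriMeasure, (measurableEmbedding_prodMk_left _).ae_map_iff,
    ← Measure.restrict_congr_set hIoc]
  filter_upwards [ae_restrict_mem (measurableSet_Ioc.prod MeasurableSet.univ)] with y hy
  have hy₂ := hy.1.2
  exact ⟨⟨le_rfl, le_add_of_nonneg_right hε, hy.1.1.le, by simp only; linarith⟩, hy.1.1⟩

theorem ae_nullMeasure_mem_regularDomain (hρ : 0 < ρs) (hε : ε < 2) :
    ∀ᵐ x ∂nullMeasure ρs ε, x ∈ regularDomain ρs ε := by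
  rw [nullMeasure, (measurableEmbedding_nullMap ρs).ae_map_iff]
  refine (withDensity_absolutelyContinuous _ _).ae_le ?_
  filter_upwards [ae_restrict_mem (measurableSet_Icc.prod MeasurableSet.univ)] with y hy
  have hτ : 0 < 1 - y.1 := by linarith [hy.1.2]
  have hpos : 0 < 2 * ρs / (1 - y.1) := by positivity
  exact ⟨⟨hy.1.1, hy.1.2, hpos.le, le_rfl⟩, hpos⟩

theorem ae_charMeasure_mem_regularDomain (hρ : 0 < ρs) (hε₀ : 0 ≤ ε) (hε₂ : ε < 2) :
    ∀ᵐ x ∂charMeasure ρs ε, x ∈ regularDomain ρs ε :=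
  ae_add_measure_iff.2
    ⟨ae_scriMeasure_mem_regularDomain hε₀, ae_nullMeasure_mem_regularDomain hρ hε₂⟩

end Supports

/-! ### The estimate for a pair of fields coupled by `X_±` -/

section Coupling

variable {ι E : Type*} (I : Finset ι) {M : ℝ}

theorem four_mul_sum_mul_sum_le (M : ℝ) (a b : ι → ℝ) :
    4 * M * (∑ i ∈ I, a i) * ∑ i ∈ I, b i ≤
      ∑ i ∈ I, a i ^ 2 + 4 * M ^ 2 * I.card ^ 2 * ∑ i ∈ I, b i ^ 2 := by
  have hterm (i : ι) : 4 * M * a i * ∑ j ∈ I, b j ≤ a i ^ 2 + 4 * M ^ 2 * (∑ j ∈ I, b j) ^ 2 := by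
    linarith [sq_nonneg (a i - 2 * M * ∑ j ∈ I, b j)]
  calc 4 * M * (∑ i ∈ I, a i) * ∑ i ∈ I, b i
      = ∑ i ∈ I, 4 * M * a i * ∑ j ∈ I, b j := by rw [← Finset.sum_mul, ← Finset.mul_sum]
    _ ≤ ∑ i ∈ I, (a i ^ 2 + 4 * M ^ 2 * (∑ j ∈ I, b j) ^ 2) := Finset.sum_le_sum fun i _ => hterm i
    _ = ∑ i ∈ I, a i ^ 2 + 4 * M ^ 2 * I.card * (∑ j ∈ I, b j) ^ 2 := by
      rw [Finset.sum_add_distrib, Finset.sum_const, nsmul_eq_mul]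
      ring
    _ ≤ ∑ i ∈ I, a i ^ 2 + 4 * M ^ 2 * I.card * (I.card * ∑ i ∈ I, b i ^ 2) := by
      gcongr
      exact sq_sum_le_card_mul_sum_sq
    _ = _ := by ring

/-- The growth rate of the energy of a system of `n` fields of each kind whose coefficients are
bounded by `M`. -/
def growthRate (M : ℝ) (n : ℕ) : ℝ := 2 * M + 4 * M ^ 2 * n ^ 2 + 1

variable [NormedAddCommGroup E] [InnerProductSpace ℝ E] {u w r e : ι → E} {k l : ι → ℝ}

-- The damping `-‖u‖²` absorbs the coupling terms, at the expense of the growth of `w`.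
theorem two_mul_sum_inner_le_growthRate (hk : ∀ i ∈ I, 1 ≤ k i) (hl : ∀ i ∈ I, l i ≤ M)
    (hr : ∀ i ∈ I, ‖r i‖ ≤ M * ∑ j ∈ I, ‖u j‖) (he : ∀ i ∈ I, ‖e i‖ ≤ M * ∑ j ∈ I, ‖w j‖) :
    2 * ∑ i ∈ I, (inner ℝ (w i) (l i • w i + r i) + inner ℝ (u i) (e i - k i • u i)) ≤
      (growthRate M I.card - 1) * ∑ i ∈ I, ‖w i‖ ^ 2 - ∑ i ∈ I, ‖u i‖ ^ 2 := by
  have hterm : ∀ i ∈ I, inner ℝ (w i) (l i • w i + r i) + inner ℝ (u i) (e i - k i • u i) ≤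
      M * ‖w i‖ ^ 2 - ‖u i‖ ^ 2 + M * (∑ j ∈ I, ‖u j‖) * ‖w i‖ +
        M * (∑ j ∈ I, ‖w j‖) * ‖u i‖ := fun i hi => by
    rw [inner_add_right, inner_sub_right, real_inner_smul_right, real_inner_smul_right,
      real_inner_self_eq_norm_sq, real_inner_self_eq_norm_sq]
    have hwr := (real_inner_le_norm (w i) (r i)).trans
      (mul_le_mul_of_nonneg_left (hr i hi) (norm_nonneg _))
    have hue := (real_inner_le_norm (u i) (e i)).trans
      (mul_le_mul_of_nonneg_left (he i hi) (norm_nonneg _))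
    have hlw := mul_le_mul_of_nonneg_right (hl i hi) (sq_nonneg ‖w i‖)
    have hku := mul_le_mul_of_nonneg_right (hk i hi) (sq_nonneg ‖u i‖)
    linarith
  have hsum := Finset.sum_le_sum hterm
  simp only [Finset.sum_add_distrib, Finset.sum_sub_distrib, ← Finset.mul_sum] at hsum ⊢
  unfold growthRate
  linarith [four_mul_sum_mul_sum_le I M (fun i => ‖u i‖) fun i => ‖w i‖]

end Coupling

section Pair

variable {m p q : ℕ}

theorem norm_sum_mul_D_le {i : ℕ × ℕ × (ℕ × ℕ × ℕ)} (hi : i ∈ multiIndices m)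
    {c : ℕ × ℕ × ℕ → ℂ} {M : ℝ} (hM : ∑ β ∈ angIdx (deg i.2.2), ‖c β‖ ≤ M) (f : Pt → ℂ) (x : Pt) :
    ‖∑ β ∈ angIdx (deg i.2.2), c β * D (i.1 + p) (i.2.1 + q) β f x‖ ≤
      M * ∑ j ∈ multiIndices m, ‖shiftedD p q j f x‖ := by
  refine le_trans ?_ (mul_le_mul_of_nonneg_right hM (Finset.sum_nonneg fun _ _ => norm_nonneg _))
  rw [Finset.sum_mul]
  refine norm_sum_le_of_le _ fun β hβ => ?_
  rw [norm_mul]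
  gcongr
  have hdeg := mem_multiIndices.1 hi
  have hle := mem_angIdx.1 hβ
  have hmem : (i.1, i.2.1, β) ∈ multiIndices m :=
    mem_multiIndices.2 (show i.1 + i.2.1 + deg β ≤ m by omega)
  exact Finset.single_le_sum (f := fun j => ‖shiftedD p q j f x‖) (fun _ _ => norm_nonneg _) hmem

theorem exists_nullSource_D (α : ℕ × ℕ × ℕ) : ∃ b c : ℕ × ℕ × ℕ → ℂ,
    ∀ (P N : ℕ) (κ κ' : ℝ) (f g : Pt → ℂ) (x : Pt), IsCkAt (P + N + deg α + 1) f x →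
      IsCkAt (P + N + deg α + 1) g x → (∀ᶠ y in 𝓝 x, nullDer 1 f y = XMinus g y - κ * f y) →
      (∀ᶠ y in 𝓝 x, nullDer (-1) g y = XPlus f y + κ' * g y) →
      nullSource (D P N α f) (D P N α g) x =
        inner ℝ (D P N α g x) ((N - P + κ') • D P N α g x +
          ∑ β ∈ angIdx (deg α), b β * D P N β f x) +
        inner ℝ (D P N α f x) (∑ β ∈ angIdx (deg α), c β * D P N β g x -
          (N - P + κ) • D P N α f x) := by
  obtain ⟨b, hb⟩ := exists_nullDer_D ![-Complex.I, -1, 0] α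
  obtain ⟨c, hc⟩ := exists_nullDer_D ![Complex.I, -1, 0] α
  rw [← XPlus_eq_angOp] at hb
  rw [← XMinus_eq_angOp] at hc
  refine ⟨b, c, fun P N κ κ' f g x hf hg hfeq hgeq => ?_⟩
  have hfeq' : ∀ᶠ y in 𝓝 x, nullDer 1 f y = XMinus g y + -κ * f y := by
    filter_upwards [hfeq] with y hy
    rw [hy]
    ring
  rw [nullSource, hb P N (-1) κ' f g x hf hg hgeq, hc P N 1 (-κ) g f x hg hf hfeq']
  simp only [Complex.real_smul]
  congr 2 <;> push_cast <;> ring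

-- `m + p < q` makes the damping rate `N - P + κ` of the derivatives of `f` at least `1`.
theorem exists_nullSource_shiftedD_le (hq : m + p < q) {κ κ' : ℝ} (hκ : 0 ≤ κ) (hκ' : κ' ≤ 1) :
    ∃ K : ℝ, 0 ≤ K ∧ ∀ (f g : Pt → ℂ) (x : Pt), IsCkAt (m + p + q + 1) f x →
      IsCkAt (m + p + q + 1) g x → (∀ᶠ y in 𝓝 x, nullDer 1 f y = XMinus g y - κ * f y) →
      (∀ᶠ y in 𝓝 x, nullDer (-1) g y = XPlus f y + κ' * g y) →
      2 * ∑ i ∈ multiIndices m, nullSource (shiftedD p q i f) (shiftedD p q i g) x ≤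
        (K - 1) * ∑ i ∈ multiIndices m, ‖shiftedD p q i g x‖ ^ 2 -
          ∑ i ∈ multiIndices m, ‖shiftedD p q i f x‖ ^ 2 := by
  choose b c hbc using exists_nullSource_D
  let B (i : ℕ × ℕ × (ℕ × ℕ × ℕ)) : ℝ := ∑ β ∈ angIdx (deg i.2.2), (‖b i.2.2 β‖ + ‖c i.2.2 β‖)
  have hB₀ (i) : 0 ≤ B i := Finset.sum_nonneg fun _ _ => by positivity
  have hB : 0 ≤ ∑ i ∈ multiIndices m, B i := Finset.sum_nonneg fun i _ => hB₀ i
  obtain ⟨M, hM⟩ : ∃ M : ℝ, M = ∑ i ∈ multiIndices m, B i + (m + q + 1) := ⟨_, rfl⟩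
  have hM₀ : 0 ≤ M := hM ▸ add_nonneg hB (by positivity)
  have hBM : ∀ i ∈ multiIndices m, B i ≤ M := fun i hi => by
    rw [hM]
    exact (Finset.single_le_sum (fun j _ => hB₀ j) hi).trans
      (le_add_of_nonneg_right (by positivity))
  refine ⟨growthRate M (multiIndices m).card, by unfold growthRate; positivity,
    fun f g x hf hg hfeq hgeq => ?_⟩
  have hord : ∀ i ∈ multiIndices m, i.1 + p + (i.2.1 + q) + deg i.2.2 + 1 ≤ m + p + q + 1 :=
    fun i hi => by have hdeg := mem_multiIndices.1 hi; omega
  refine (congrArg (2 * ·) (Finset.sum_congr rfl fun i hi => hbc _ _ _ κ κ' f g x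
    (hf.of_le (hord i hi)) (hg.of_le (hord i hi)) hfeq hgeq)).trans_le
    (two_mul_sum_inner_le_growthRate _ (fun i hi => ?_) (fun i hi => ?_)
      (fun i hi => norm_sum_mul_D_le hi (le_trans ?_ (hBM i hi)) f x)
      fun i hi => norm_sum_mul_D_le hi (le_trans ?_ (hBM i hi)) g x)
  · have hdeg := mem_multiIndices.1 hi
    have hlt : ((i.1 + p : ℕ) : ℝ) + 1 ≤ (i.2.1 + q : ℕ) := by exact_mod_cast (by omega)
    linarith
  · have hdeg := mem_multiIndices.1 hi
    have hle : ((i.2.1 + q : ℕ) : ℝ) ≤ m + q + (i.1 + p : ℕ) := by exact_mod_cast (by omega)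
    linarith
  · exact Finset.sum_le_sum fun β _ => le_add_of_nonneg_right (norm_nonneg _)
  · exact Finset.sum_le_sum fun β _ => le_add_of_nonneg_left (norm_nonneg _)

theorem exists_shiftedSobolevSq_pair_le (hq : m + p < q) {κ κ' : ℝ} (hκ : 0 ≤ κ) (hκ' : κ' ≤ 1) :
    ∃ C : ℝ, 0 < C ∧ ∀ (ρs ε : ℝ), 0 < ρs → 0 ≤ ε → ε ≤ 1 → ∀ f g : Pt → ℂ,
      (∀ x ∈ regularDomain ρs ε, IsCkAt (m + p + q + 1) f x) →
      (∀ x ∈ regularDomain ρs ε, IsCkAt (m + p + q + 1) g x) →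
      (∀ x ∈ regularDomain ρs ε, nullDer 1 f x = XMinus g x - κ * f x) →
      (∀ x ∈ regularDomain ρs ε, nullDer (-1) g x = XPlus f x + κ' * g x) →
      shiftedSobolevSq m p q (dv.restrict (lowerDomain ρs ε)) f +
          shiftedSobolevSq m p q (dv.restrict (lowerDomain ρs ε)) g ≤
        ENNReal.ofReal C * (shiftedSobolevSq m p q (charMeasure ρs ε) f +
          shiftedSobolevSq m p q (charMeasure ρs ε) g) := by
  obtain ⟨K, hK, hsource⟩ := exists_nullSource_shiftedD_le (m := m) hq hκ hκ'
  refine ⟨2 * Real.exp K, by positivity, fun ρs ε hρ hε₀ hε₁ f g hf hg hfeq hgeq => ?_⟩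
  have henergy := lintegral_lowerDomain_energy_le (multiIndices m) hK hρ hε₀ hε₁
    (fun i hi x hx => IsCkAt.shiftedD hi (hf x hx)) (fun i hi x hx => IsCkAt.shiftedD hi (hg x hx))
    fun x hx => hsource f g x (hf x (interior_subset hx)) (hg x (interior_subset hx))
      (Filter.mem_of_superset (mem_interior_iff_mem_nhds.1 hx) hfeq)
      (Filter.mem_of_superset (mem_interior_iff_mem_nhds.1 hx) hgeq)
  have hmeas {h : Pt → ℂ} (hh : ∀ x ∈ regularDomain ρs ε, IsCkAt (m + p + q + 1) h x) :
      ∀ i ∈ multiIndices m, AEMeasurable (fun x => ‖shiftedD p q i h x‖ₑ ^ 2)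
        (dv.restrict (lowerDomain ρs ε)) := fun i hi =>
    aemeasurable_enorm_shiftedD_sq (measurableSet_regularDomain ρs ε)
      (ae_restrict_lowerDomain_mem_regularDomain ρs ε) hi fun x hx => (hh x hx).of_le (by omega)
  calc _ = ∫⁻ x in lowerDomain ρs ε,
        ∑ i ∈ multiIndices m, (‖shiftedD p q i f x‖ₑ ^ 2 + ‖shiftedD p q i g x‖ₑ ^ 2) ∂dv := by
        rw [shiftedSobolevSq, shiftedSobolevSq, ← Finset.sum_add_distrib]
        refine .trans (Finset.sum_congr rfl fun i hi => ?_)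
          (lintegral_finsetSum' _ fun i hi => (hmeas hf i hi).add (hmeas hg i hi)).symm
        exact (lintegral_add_left' (hmeas hf i hi) _).symm
    _ ≤ _ := henergy
    _ ≤ _ := by
      rw [add_comm (shiftedSobolevSq m p q (charMeasure ρs ε) f), shiftedSobolevSq,
        shiftedSobolevSq, ← Finset.sum_add_distrib]
      gcongr
      exacts [Measure.le_add_right le_rfl, Measure.le_add_left le_rfl]

end Pair

/-! ### The transport equations -/

/-- The characteristic field `ψ₁ + s ψ`. For `s = ±1/2` these fields decouple the transport
equations into two pairs. -/
def charField (s : ℂ) (ψ ψ₁ : Pt → ℂ) : Pt → ℂ := fun y => ψ₁ y + s * ψ y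

/-- The fields `ψ, ψ₀, ψ₁, ψ₂` solve the transport equations on `S` and are of class `C^n` near
every point of `S`. -/
structure IsTransportSolution (n : ℕ) (S : Set Pt) (ψ ψ₀ ψ₁ ψ₂ : Pt → ℂ) : Prop where
  isCkAt : ∀ f ∈ ({ψ, ψ₀, ψ₁, ψ₂} : Set (Pt → ℂ)), ∀ x ∈ S, IsCkAt n f x
  transportEqAt : ∀ x ∈ S, TransportEqAt ψ ψ₀ ψ₁ ψ₂ x

section Transport

variable {m n p q : ℕ} {ψ ψ₀ ψ₁ ψ₂ : Pt → ℂ}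

theorem charField_eq_mul_add_mul (s : ℂ) (ψ ψ₁ : Pt → ℂ) :
    charField s ψ ψ₁ = fun y => 1 * ψ₁ y + s * ψ y := by
  funext y
  rw [charField, one_mul]

theorem TransportEqAt.nullDer_eq {x : Pt} (h : TransportEqAt ψ ψ₀ ψ₁ ψ₂ x) (hψ : IsCkAt 1 ψ x)
    (hψ₁ : IsCkAt 1 ψ₁ x) :
    nullDer 1 ψ₂ x = XMinus (charField (1 / 2) ψ ψ₁) x ∧
    nullDer (-1) (charField (1 / 2) ψ ψ₁) x = XPlus ψ₂ x + charField (1 / 2) ψ ψ₁ x ∧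
    nullDer 1 (charField (-(1 / 2)) ψ ψ₁) x = XMinus ψ₀ x - charField (-(1 / 2)) ψ ψ₁ x ∧
    nullDer (-1) ψ₀ x = XPlus (charField (-(1 / 2)) ψ ψ₁) x := by
  have hnull (r s : ℂ) : nullDer r (charField s ψ ψ₁) x = nullDer r ψ₁ x + s * nullDer r ψ x := by
    rw [charField_eq_mul_add_mul, nullDer_mul_add_mul hψ₁ hψ, one_mul]
  have hang (a : Fin 3 → ℂ) (s : ℂ) :
      angOp a (charField s ψ ψ₁) x = angOp a ψ₁ x + s * angOp a ψ x := by
    rw [charField_eq_mul_add_mul, angOp_mul_add_mul hψ₁ hψ, one_mul]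
  obtain ⟨h₂, hplus, hminus, h₀⟩ := h
  simp only [XPlus_eq_angOp, XMinus_eq_angOp] at h₂ hplus hminus h₀ ⊢
  simp only [hnull, hang]
  simp only [nullDer, charField]
  refine ⟨?_, ?_, ?_, ?_⟩
  · linear_combination h₂
  · linear_combination hplus
  · linear_combination hminus
  · linear_combination h₀

theorem IsCkAt.charField {x : Pt} (hψ : IsCkAt n ψ x) (hψ₁ : IsCkAt n ψ₁ x) (s : ℂ) :
    IsCkAt n (charField s ψ ψ₁) x :=
  hψ₁.add (hψ.const_mul s)

section Norms

variable {ν : Measure Pt} {S : Set Pt} (hS : MeasurableSet S) (hν : ∀ᵐ x ∂ν, x ∈ S)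
  (hψ : ∀ x ∈ S, IsCkAt (m + p + q) ψ x) (hψ₁ : ∀ x ∈ S, IsCkAt (m + p + q) ψ₁ x)

include hS hν hψ hψ₁

theorem shiftedSobolevSq_charField_le {s : ℂ} (hs : ‖s‖ ≤ 1) :
    shiftedSobolevSq m p q ν (charField s ψ ψ₁) ≤
      2 * shiftedSobolevSq m p q ν ψ₁ + 2 * shiftedSobolevSq m p q ν ψ := by
  rw [charField_eq_mul_add_mul]
  exact shiftedSobolevSq_mul_add_mul_le hS hν hψ₁ hψ norm_one.le hs

theorem shiftedSobolevSq_add_le_charField :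
    shiftedSobolevSq m p q ν ψ₁ + shiftedSobolevSq m p q ν ψ ≤
      4 * (shiftedSobolevSq m p q ν (charField (1 / 2) ψ ψ₁) +
        shiftedSobolevSq m p q ν (charField (-(1 / 2)) ψ ψ₁)) := by
  have hchar (s : ℂ) : ∀ x ∈ S, IsCkAt (m + p + q) (charField s ψ ψ₁) x := fun x hx =>
    (hψ x hx).charField (hψ₁ x hx) s
  have hcomb {s t : ℂ} (hs : ‖s‖ ≤ 1) (ht : ‖t‖ ≤ 1) :=
    shiftedSobolevSq_mul_add_mul_le hS hν (hchar (1 / 2)) (hchar (-(1 / 2))) hs ht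
  have hψ₁_eq : ψ₁ = fun y => 1 / 2 * charField (1 / 2) ψ ψ₁ y +
      1 / 2 * charField (-(1 / 2)) ψ ψ₁ y := by
    funext y
    simp only [charField]
    ring
  have hψ_eq : ψ = fun y => 1 * charField (1 / 2) ψ ψ₁ y +
      -1 * charField (-(1 / 2)) ψ ψ₁ y := by
    funext y
    simp only [charField]
    ring
  calc shiftedSobolevSq m p q ν ψ₁ + shiftedSobolevSq m p q ν ψ
      ≤ (2 * shiftedSobolevSq m p q ν (charField (1 / 2) ψ ψ₁) +
          2 * shiftedSobolevSq m p q ν (charField (-(1 / 2)) ψ ψ₁)) +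
        (2 * shiftedSobolevSq m p q ν (charField (1 / 2) ψ ψ₁) +
          2 * shiftedSobolevSq m p q ν (charField (-(1 / 2)) ψ ψ₁)) :=
        add_le_add ((congrArg _ hψ₁_eq).trans_le (hcomb (by norm_num) (by norm_num)))
          ((congrArg _ hψ_eq).trans_le (hcomb (by norm_num) (by norm_num)))
    _ = _ := by ring

end Norms

theorem exists_shiftedSobolevSq_charField_le (hq : m + p < q) :
    ∃ C : ℝ, 0 < C ∧ ∀ (ρs ε : ℝ), 0 < ρs → 0 ≤ ε → ε ≤ 1 → ∀ ψ ψ₀ ψ₁ ψ₂ : Pt → ℂ,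
      IsTransportSolution (m + p + q + 1) (regularDomain ρs ε) ψ ψ₀ ψ₁ ψ₂ →
      shiftedSobolevSq m p q (dv.restrict (lowerDomain ρs ε)) ψ₂ +
          shiftedSobolevSq m p q (dv.restrict (lowerDomain ρs ε)) (charField (1 / 2) ψ ψ₁) +
          (shiftedSobolevSq m p q (dv.restrict (lowerDomain ρs ε)) (charField (-(1 / 2)) ψ ψ₁) +
          shiftedSobolevSq m p q (dv.restrict (lowerDomain ρs ε)) ψ₀) ≤
        ENNReal.ofReal C * (shiftedSobolevSq m p q (charMeasure ρs ε) ψ₂ +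
          shiftedSobolevSq m p q (charMeasure ρs ε) (charField (1 / 2) ψ ψ₁) +
          (shiftedSobolevSq m p q (charMeasure ρs ε) (charField (-(1 / 2)) ψ ψ₁) +
          shiftedSobolevSq m p q (charMeasure ρs ε) ψ₀)) := by
  obtain ⟨C₁, hC₁, hpair₁⟩ := exists_shiftedSobolevSq_pair_le hq le_rfl le_rfl
  obtain ⟨C₂, -, hpair₂⟩ := exists_shiftedSobolevSq_pair_le hq zero_le_one zero_le_one
  refine ⟨max C₁ C₂, lt_max_of_lt_left hC₁, fun ρs ε hρ hε₀ hε₁ ψ ψ₀ ψ₁ ψ₂ hsol => ?_⟩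
  have hψ := hsol.isCkAt ψ (by simp)
  have hψ₁ := hsol.isCkAt ψ₁ (by simp)
  have hnull := fun x hx => (hsol.transportEqAt x hx).nullDer_eq
    ((hψ x hx).of_le (by omega)) ((hψ₁ x hx).of_le (by omega))
  have hplus := hpair₁ ρs ε hρ hε₀ hε₁ ψ₂ (charField (1 / 2) ψ ψ₁) (hsol.isCkAt ψ₂ (by simp))
    (fun x hx => (hψ x hx).charField (hψ₁ x hx) _)
    (fun x hx => by simpa using (hnull x hx).1) (fun x hx => by simpa using (hnull x hx).2.1)
  have hminus := hpair₂ ρs ε hρ hε₀ hε₁ (charField (-(1 / 2)) ψ ψ₁) ψ₀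
    (fun x hx => (hψ x hx).charField (hψ₁ x hx) _) (hsol.isCkAt ψ₀ (by simp))
    (fun x hx => by simpa using (hnull x hx).2.2.1) (fun x hx => by simpa using (hnull x hx).2.2.2)
  rw [mul_add]
  gcongr
  · exact hplus.trans (by gcongr; exact le_max_left _ _)
  · exact hminus.trans (by gcongr; exact le_max_right _ _)

theorem exists_shiftedSobolevSq_le (hq : m + p < q) :
    ∃ C : ℝ, 0 < C ∧ ∀ (ρs ε : ℝ), 0 < ρs → 0 ≤ ε → ε ≤ 1 → ∀ ψ ψ₀ ψ₁ ψ₂ : Pt → ℂ,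
      IsTransportSolution (m + p + q + 1) (regularDomain ρs ε) ψ ψ₀ ψ₁ ψ₂ →
      ∀ B : ℝ≥0∞, (∀ f ∈ ({ψ, ψ₀, ψ₁, ψ₂} : Set (Pt → ℂ)),
        shiftedSobolevSq m p q (charMeasure ρs ε) f ≤ B) →
      shiftedSobolevSq m p q (dv.restrict (lowerDomain ρs ε)) ψ₀ +
          shiftedSobolevSq m p q (dv.restrict (lowerDomain ρs ε)) ψ₁ +
          shiftedSobolevSq m p q (dv.restrict (lowerDomain ρs ε)) ψ ≤ ENNReal.ofReal C * B := by
  obtain ⟨C, hC, hestimate⟩ := exists_shiftedSobolevSq_charField_le hq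
  refine ⟨40 * C, by positivity, fun ρs ε hρ hε₀ hε₁ ψ ψ₀ ψ₁ ψ₂ hsol B hB => ?_⟩
  have hψ (x) (hx : x ∈ regularDomain ρs ε) : IsCkAt (m + p + q) ψ x :=
    (hsol.isCkAt ψ (by simp) x hx).of_le (Nat.le_succ _)
  have hψ₁ (x) (hx : x ∈ regularDomain ρs ε) : IsCkAt (m + p + q) ψ₁ x :=
    (hsol.isCkAt ψ₁ (by simp) x hx).of_le (Nat.le_succ _)
  have hdata {s : ℂ} (hs : ‖s‖ ≤ 1) :
      shiftedSobolevSq m p q (charMeasure ρs ε) (charField s ψ ψ₁) ≤ 2 * B + 2 * B :=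
    (shiftedSobolevSq_charField_le (measurableSet_regularDomain ρs ε)
      (ae_charMeasure_mem_regularDomain hρ hε₀ (by linarith)) hψ hψ₁ hs).trans
      (by gcongr <;> exact hB _ (by simp))
  have hbulk := shiftedSobolevSq_add_le_charField (measurableSet_regularDomain ρs ε)
    (ae_restrict_lowerDomain_mem_regularDomain ρs ε) hψ hψ₁
  have hchar := (hestimate ρs ε hρ hε₀ hε₁ ψ ψ₀ ψ₁ ψ₂ hsol).trans (mul_le_mul_right
    (add_le_add (add_le_add (hB ψ₂ (by simp)) (hdata (by norm_num)))
      (add_le_add (hdata (by norm_num)) (hB ψ₀ (by simp)))) _)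
  generalize shiftedSobolevSq m p q (dv.restrict (lowerDomain ρs ε)) = N at hbulk hchar ⊢
  calc N ψ₀ + N ψ₁ + N ψ
      ≤ 4 * N ψ₀ + 4 * (N (charField (1 / 2) ψ ψ₁) + N (charField (-(1 / 2)) ψ ψ₁)) := by
        rw [add_assoc]
        gcongr
        exact le_mul_of_one_le_left' (by norm_num)
    _ ≤ 4 * (N ψ₂ + N (charField (1 / 2) ψ ψ₁) + (N (charField (-(1 / 2)) ψ ψ₁) + N ψ₀)) := by
        rw [← mul_add]
        exact mul_le_mul_right ((le_add_self (b := N ψ₂)).trans_eq (by ring)) 4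
    _ ≤ 4 * (ENNReal.ofReal C * (B + (2 * B + 2 * B) + ((2 * B + 2 * B) + B))) := by gcongr
    _ = ENNReal.ofReal (40 * C) * B := by
        rw [ENNReal.ofReal_mul (by norm_num), ENNReal.ofReal_ofNat]
        ring

end Transport

end FriedrichCylinder

end

theorem proposition3 (m p q : ℕ) (hq : m + p < q) :
    ∃ C : ℝ, 0 < C ∧
      ∀ (ρs ε : ℝ), 0 < ρs → 0 < ε → ε < 1 →
      ∀ (ψ ψ₀ ψ₁ ψ₂ : Pt → ℂ),
        (∀ f ∈ ({ψ, ψ₀, ψ₁, ψ₂} : Set (Pt → ℂ)), ∀ x ∈ lowerDomain ρs ε, 0 < x.2.1 →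
          IsCkAt (m + p + q + 1) f x) →
        (∀ x ∈ lowerDomain ρs ε, 0 < x.2.1 → TransportEqAt ψ ψ₀ ψ₁ ψ₂ x) →
      ∀ Ω : ℝ, 0 < Ω →
        (∀ f ∈ ({ψ, ψ₀, ψ₁, ψ₂} : Set (Pt → ℂ)),
          scriDataSq m ρs (dTau^[q] (dRho^[p] f))
            + nullDataSq m ρs ε (dTau^[q] (dRho^[p] f)) ≤ ENNReal.ofReal Ω) →
        sobolevSq m (lowerDomain ρs ε) (dRho^[p] (dTau^[q] ψ₀))
          + sobolevSq m (lowerDomain ρs ε) (dRho^[p] (dTau^[q] ψ₁))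
          + sobolevSq m (lowerDomain ρs ε) (dRho^[p] (dTau^[q] ψ)) ≤ ENNReal.ofReal (C * Ω) := by
  obtain ⟨C, hC, hestimate⟩ := exists_shiftedSobolevSq_le hq
  refine ⟨C, hC, fun ρs ε hρ hε₀ hε₁ ψ ψ₀ ψ₁ ψ₂ hreg htr Ω _ hdata => ?_⟩
  have hsol : IsTransportSolution (m + p + q + 1) (regularDomain ρs ε) ψ ψ₀ ψ₁ ψ₂ :=
    ⟨fun f hf x hx => hreg f hf x hx.1 hx.2, fun x hx => htr x hx.1 hx.2⟩
  have hCk (f) (hf : f ∈ ({ψ, ψ₀, ψ₁, ψ₂} : Set (Pt → ℂ))) (x) (hx : x ∈ regularDomain ρs ε) :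
      IsCkAt (m + p + q) f x := (hsol.isCkAt f hf x hx).of_le (Nat.le_succ _)
  have hbulk (f) (hf : f ∈ ({ψ, ψ₀, ψ₁, ψ₂} : Set (Pt → ℂ))) :
      sobolevSq m (lowerDomain ρs ε) (dRho^[p] (dTau^[q] f)) =
        shiftedSobolevSq m p q (dv.restrict (lowerDomain ρs ε)) f := by
    rw [sobolevSq_eq_shiftedSobolevSq,
      shiftedSobolevSq_dRho_dTau (ae_restrict_lowerDomain_mem_regularDomain ρs ε) (hCk f hf)]
  rw [hbulk ψ₀ (by simp), hbulk ψ₁ (by simp), hbulk ψ (by simp), ENNReal.ofReal_mul hC.le]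
  refine hestimate ρs ε hρ hε₀.le hε₁.le ψ ψ₀ ψ₁ ψ₂ hsol _ fun f hf => ?_
  rw [← shiftedSobolevSq_dTau_dRho (ae_charMeasure_mem_regularDomain hρ hε₀.le (by linarith))
    (hCk f hf), ← scriDataSq_add_nullDataSq]
  exact hdata f hf
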